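/- Let $f$ be a probability density on $\mathbb{R}$ which vanishes on $(-\infty,0)$ and is positive and $C^3$ on $(0,\infty)$. Let $A>0$ and $\kappa>0$, and write $g(x)\cong h(x)$ if $g(x)/h(x)\to 1$. Assume, as $x\to+0$: $f(x)\cong A x^{\kappa-1}$; if $\kappa\neq 1$, $f'(x)\cong A(\kappa-1)x^{\kappa-2}$; if $\kappa\notin\{1,2\}$, $f''(x)\cong A(\kappa-1)(\kappa-2)x^{\kappa-3}$; if $\kappa=2$, $x f''(x)\to 0$; if $\kappa=1$, the finite limits $\lim_{x\to+0}f'(x)$ and $\lim_{x\to+0}f''(x)$ exist. Assume also that there are $c>0$ and $\delta>0$ with $\int_c^\infty \frac{f'(x)^2}{f(x)}\,dx<\infty$ and $$\int_c^\infty \sup_{0\le t\le\delta} f(x+t)\,\sup_{0\le t\le\delta}|h(x+t)|\,dx<\infty\quad\text{for } h=\frac{(f')^3}{f^3},\ h=\frac{f'f''}{f^2},\ h=\frac{f'''}{f}.$$ For $0<s<1$ let $I^s(p\|q)=-\log\int_{\mathbb{R}} p(x)^s q(x)^{1-s}\,dx$ be the relative Rényi entropy of the densities $p,q$, let $f_\theta(x)=f(x-\theta)$,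 let $J_f=\int_0^\infty \frac{f'(x)^2}{f(x)}\,dx$, and let $B$ be the beta function. Then for every $\theta\in\mathbb{R}$ $$\lim_{\epsilon\to+0}\frac{I^s(f_\theta\|f_{\theta+\epsilon})}{\epsilon^\kappa}=\begin{cases}\frac{1-\kappa}{\kappa}\,A s\,B(s+\kappa(1-s),1-\kappa), & 0<\kappa<1,\\ A s, & \kappa=1,\\ \frac{1}{\kappa}\,A s\,(1-s(\kappa-1))\,B(s+\kappa(1-s),2-\kappa), & 1<\kappa<2,\end{cases}$$ $$\lim_{\epsilon\to+0}\frac{I^s(f_\theta\|f_{\theta+\epsilon})}{-\epsilon^2\log\epsilon}=\frac{A s(1-s)}{2}\quad\text{if }\kappa=2,$$ $$J_f<\infty\quad\text{and}\quad\lim_{\epsilon\to+0}\frac{I^s(f_\theta\|f_{\theta+\epsilon})}{\epsilon^2}=\frac{s(1-s)}{2}J_f\quad\text{if }\kappa>2,$$ and all these convergences are uniform in $s\in(0,1)$. Moreover, for all $\alpha,\beta>0$ the assumptions are satisfied by the Weibull density $\alpha\beta x^{\alpha-1}e^{-\beta x^\alpha}$ $(x>0)$ with $\kappa=\alpha$,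 $A=\alpha\beta$, and by the gamma density $\frac{\beta^\alpha}{\Gamma(\alpha)}x^{\alpha-1}e^{-\beta x}$ $(x>0)$ with $\kappa=\alpha$, $A=\frac{\beta^\alpha}{\Gamma(\alpha)}$. -/

import Mathlib

open Filter Topology Asymptotics MeasureTheory Set

namespace LocationShift

/-- The relative Rényi entropy `I^s(p‖q) = -log ∫ p^s q^(1-s)` of two densities on the real line.
For probability densities and `0 < s < 1` the integrand is integrable (it is at most
`s p + (1-s) q`). -/
noncomputable def relRenyi (s : ℝ) (p q : ℝ → ℝ) : ℝ :=
  -Real.log (∫ x, p x ^ s * q x ^ (1 - s))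

/-- The member `f_θ(x) = f(x - θ)` of the location-shift family generated by `f`. -/
def shift (f : ℝ → ℝ) (θ : ℝ) : ℝ → ℝ := fun x => f (x - θ)

/-- `f` is a probability density whose support is the half-line `(0,∞)` and which is
`C³` there. -/
structure IsHalfLineDensity (f : ℝ → ℝ) : Prop where
  nonneg : ∀ x, 0 ≤ f x
  eq_zero : ∀ x, x < 0 → f x = 0
  pos : ∀ x, 0 < x → 0 < f x
  integrable : Integrable f
  integral_eq_one : ∫ x, f x = 1
  contDiffOn : ContDiffOn ℝ 3 f (Ioi 0)

/-- The behaviour of `f` at the endpoint `0`, of order `κ > 0` with coefficient `A > 0`. -/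
structure EndpointCondition (f : ℝ → ℝ) (A κ : ℝ) : Prop where
  A_pos : 0 < A
  kappa_pos : 0 < κ
  equiv : f ~[𝓝[>] 0] fun x => A * x ^ (κ - 1)
  equiv_deriv : κ ≠ 1 → deriv f ~[𝓝[>] 0] fun x => A * (κ - 1) * x ^ (κ - 2)
  equiv_deriv2 : κ ≠ 1 → κ ≠ 2 →
    iteratedDeriv 2 f ~[𝓝[>] 0] fun x => A * (κ - 1) * (κ - 2) * x ^ (κ - 3)
  tendsto_of_two : κ = 2 → Tendsto (fun x => x * iteratedDeriv 2 f x) (𝓝[>] 0) (𝓝 0)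
  limit_deriv_of_one : κ = 1 → ∃ l : ℝ, Tendsto (deriv f) (𝓝[>] 0) (𝓝 l)
  limit_deriv2_of_one : κ = 1 → ∃ l : ℝ, Tendsto (iteratedDeriv 2 f) (𝓝[>] 0) (𝓝 l)

/-- `sup_{0 ≤ t ≤ δ} g(x + t)`. -/
noncomputable def supShift (δ : ℝ) (g : ℝ → ℝ) (x : ℝ) : ℝ :=
  ⨆ t : Icc (0 : ℝ) δ, g (x + t)

/-- The integrability conditions on the tail of `f`. All integrands are nonnegative, and
continuous on `(c,∞)` for a positive `C³` function `f`, so that integrability is finiteness of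
the integral. -/
def TailCondition (f : ℝ → ℝ) : Prop :=
  ∃ c : ℝ, 0 < c ∧ ∃ δ : ℝ, 0 < δ ∧
    IntegrableOn (fun x => (f x)⁻¹ * deriv f x ^ 2) (Ioi c) ∧
    IntegrableOn (fun x => supShift δ f x *
      supShift δ (fun y => |(f y ^ 3)⁻¹ * deriv f y ^ 3|) x) (Ioi c) ∧
    IntegrableOn (fun x => supShift δ f x *
      supShift δ (fun y => |(f y ^ 2)⁻¹ * deriv f y * iteratedDeriv 2 f y|) x) (Ioi c) ∧
    IntegrableOn (fun x => supShift δ f x *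
      supShift δ (fun y => |(f y)⁻¹ * iteratedDeriv 3 f y|) x) (Ioi c)

/-- The standing assumptions on the generating density. -/
structure Admissible (f : ℝ → ℝ) (A κ : ℝ) : Prop where
  density : IsHalfLineDensity f
  endpoint : EndpointCondition f A κ
  tail : TailCondition f

/-- The Fisher information `J_f = ∫_0^∞ f⁻¹ (f')²`. -/
noncomputable def fisherInfo (f : ℝ → ℝ) : ℝ :=
  ∫ x in Ioi (0 : ℝ), (f x)⁻¹ * deriv f x ^ 2

/-- The density `α β x^(α-1) exp(-β x^α)` on the half-line of the Weibull distribution. -/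
noncomputable def weibullPDF (α β x : ℝ) : ℝ :=
  if 0 ≤ x then α * β * x ^ (α - 1) * Real.exp (-(β * x ^ α)) else 0

/-- `R ε s → L s` as `ε → +0`, uniformly for `0 < s < 1`. -/
def UniformLimit (R : ℝ → ℝ → ℝ) (L : ℝ → ℝ) : Prop :=
  TendstoUniformlyOn R L (𝓝[>] 0) (Ioo 0 1)

end LocationShift

namespace LocationShift

/-! ### The gap between weighted means -/

/-! The affinity `∫ f_θ^s f_{θ+ε}^(1-s)` equals `1 - deficit` (`integral_shift_rpow`). The deficit
is `s` times the mass of `(0, ε]`, which lies outside the support of the shifted density, plus the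
integral over `(0,∞)` of `meanGap`, the arithmetic minus the geometric mean of `f (x + ε)` and `f
x`. Every term is nonnegative, so the regions of `x` can be estimated separately, and `-log (1 - u)
= u + O(u²)` carries the rate over to the entropy (`uniformLimit_of_tendsto_deficit`). Uniformity in
`s` comes from using only bounds free of `s` and taking limits along `shiftFilter`.

Away from the endpoint, a third order Taylor expansion of the gap, with the tail conditions as
majorant of the remainder, gives `s(1-s)/2 · ε² ∫ (f')²/f + O(ε³)` (`exists_tail_bound`). Near the
endpoint `f` behaves like `A x^(κ-1)`, and the gap is at most a constant times `ε^(κ-1) · scaleBound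
(κ-1) (x/ε)`, where `scaleBound (κ-1) y` is `y^(κ-3)` for large `y`. Three regimes follow.

For `κ < 2` this majorant is integrable up to infinity, so a layer of width of order `ε` dominates.
The substitution `x = ε y`, homogeneity of the gap and dominated convergence
(`Admissible.tendsto_near`) give `ε^κ` times `A ∫ meanGap s ((y+1)^(κ-1)) (y^(κ-1)) dy`. An explicit
antiderivative reduces this integral to a beta function (`integral_meanGap_rpow`), and its boundary
term cancels the mass of `(0, ε]`.

For `κ = 2` the gap on the range `ε ≪ x ≪ 1` is close to `s(1-s)/2 · A ε²/x`, whose integral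
produces the logarithm; everything else is `O(ε²)` (`Admissible.exists_abs_deficit_sub_le`). For `κ
> 2` the gap near the endpoint is `ε²` times an integrable function, so that region is negligible
and the Fisher information remains (`Admissible.tendsto_deficit_of_two_lt`).

Both examples have the form `C x^(α-1) exp(-β x^γ)`. The quotients `f^(k)/f` are then polynomials in
`x^γ` divided by `x^k`, so the endpoint and tail conditions can be read off. -/

/-- The filter `ε → +0`, with `s` ranging freely over `(0,1)`. -/
abbrev shiftFilter : Filter (ℝ × ℝ) := 𝓝[>] (0 : ℝ) ×ˢ 𝓟 (Ioo (0 : ℝ) 1)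

/-- The gap between the weighted arithmetic and geometric means of `a` and `b`. -/
noncomputable def meanGap (s a b : ℝ) : ℝ := s * a + (1 - s) * b - a ^ s * b ^ (1 - s)

lemma meanGap_nonneg {s a b : ℝ} (hs : s ∈ Ioo (0 : ℝ) 1) (ha : 0 ≤ a) (hb : 0 ≤ b) :
    0 ≤ meanGap s a b := by
  have := Real.geom_mean_le_arith_mean2_weighted hs.1.le (sub_nonneg.2 hs.2.le) ha hb (by ring)
  unfold meanGap; linarith

lemma meanGap_le_add {s a b : ℝ} (hs : s ∈ Ioo (0 : ℝ) 1) (ha : 0 ≤ a) (hb : 0 ≤ b) :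
    meanGap s a b ≤ a + b := by
  have h1 : 0 ≤ a ^ s * b ^ (1 - s) := by positivity
  have h2 : 0 ≤ (1 - s) * a := mul_nonneg (sub_nonneg.2 hs.2.le) ha
  have h3 : 0 ≤ s * b := mul_nonneg hs.1.le hb
  unfold meanGap; linarith

/-- This homogeneity lets powers of `ε`, the constant `A` or the value `f x` be factored out of the
gap. -/
lemma meanGap_mul {s a b c : ℝ} (hc : 0 ≤ c) (ha : 0 ≤ a) (hb : 0 ≤ b) :
    meanGap s (c * a) (c * b) = c * meanGap s a b := by
  unfold meanGap
  rw [Real.mul_rpow hc ha, Real.mul_rpow hc hb]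
  have : c ^ s * c ^ (1 - s) = c := by
    rw [← Real.rpow_add' hc (by simp)]; simp
  linear_combination (- a ^ s * b ^ (1 - s)) * this

/-- The geometric mean dominates the harmonic mean, and the arithmetic minus the harmonic mean is an
explicit multiple of `(a - b)²`. -/
lemma meanGap_le_sq {s a b m : ℝ} (hs : s ∈ Ioo (0 : ℝ) 1) (hm : 0 < m) (ha : m ≤ a)
    (hb : m ≤ b) : meanGap s a b ≤ (a - b) ^ 2 / m := by
  obtain ⟨h0, h1⟩ := hs
  have ha' := hm.trans_le ha
  have hb' := hm.trans_le hb
  have hD : m ≤ s * b + (1 - s) * a := by nlinarith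
  have hD0 := hm.trans_le hD
  have hG : 0 < a ^ s * b ^ (1 - s) := by positivity
  have key := Real.geom_mean_le_arith_mean2_weighted h0.le (sub_nonneg.2 h1.le)
    (inv_nonneg.2 ha'.le) (inv_nonneg.2 hb'.le) (by ring)
  rw [Real.inv_rpow ha'.le, Real.inv_rpow hb'.le, ← mul_inv] at key
  -- The inequality of means applied to `a⁻¹` and `b⁻¹`, inverted.
  have key2 : a * b / (s * b + (1 - s) * a) ≤ a ^ s * b ^ (1 - s) := by
    rw [show s * a⁻¹ + (1 - s) * b⁻¹ = (a * b / (s * b + (1 - s) * a))⁻¹ by field_simp] at key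
    exact (inv_le_inv₀ hG (by positivity)).1 key
  have e : s * a + (1 - s) * b - a * b / (s * b + (1 - s) * a)
      = s * (1 - s) * (a - b) ^ 2 / (s * b + (1 - s) * a) := by
    field_simp; ring
  calc meanGap s a b ≤ s * (1 - s) * (a - b) ^ 2 / (s * b + (1 - s) * a) := by
        unfold meanGap; linarith
    _ ≤ (a - b) ^ 2 / m := by
        gcongr
        have : s * (1 - s) ≤ 1 := by nlinarith
        nlinarith [sq_nonneg (a - b)]

/-- The weight `s q` need not converge, so continuity of the gap is stated as a difference tending
to zero. This is what makes the pointwise limits uniform in `s`. -/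
lemma tendsto_meanGap_sub {ι : Type*} {l : Filter ι} {s u v : ι → ℝ} {a b : ℝ}
    (hs : ∀ᶠ q in l, s q ∈ Ioo (0 : ℝ) 1) (ha : 0 < a) (hb : 0 < b)
    (hu : Tendsto u l (𝓝 a)) (hv : Tendsto v l (𝓝 b)) :
    Tendsto (fun q => meanGap (s q) (u q) (v q) - meanGap (s q) a b) l (𝓝 0) := by
  -- Coefficients depending on `s` enter only through the bound `1` on their absolute value.
  have hbd : ∀ {w : ι → ℝ} {r : ι → ℝ}, (∀ᶠ q in l, |r q| ≤ 1) → Tendsto w l (𝓝 0) →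
      Tendsto (fun q => r q * w q) l (𝓝 0) := by
    intro w r hr hw
    refine squeeze_zero_norm' (a := fun q => |w q|) ?_ (by simpa using hw.abs)
    filter_upwards [hr] with q hq
    rw [Real.norm_eq_abs, abs_mul]
    exact mul_le_of_le_one_left (abs_nonneg _) hq
  have hs1 : ∀ᶠ q in l, |s q| ≤ 1 := hs.mono fun q hq => abs_le.2 ⟨by linarith [hq.1], hq.2.le⟩
  have hs2 : ∀ᶠ q in l, |1 - s q| ≤ 1 :=
    hs.mono fun q hq => abs_le.2 ⟨by linarith [hq.2], by linarith [hq.1]⟩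
  have hu0 : Tendsto (fun q => u q - a) l (𝓝 0) := by simpa using hu.sub_const a
  have hv0 : Tendsto (fun q => v q - b) l (𝓝 0) := by simpa using hv.sub_const b
  have hlu : Tendsto (fun q => Real.log (u q) - Real.log a) l (𝓝 0) := by
    simpa using (hu.log ha.ne').sub_const (Real.log a)
  have hlv : Tendsto (fun q => Real.log (v q) - Real.log b) l (𝓝 0) := by
    simpa using (hv.log hb.ne').sub_const (Real.log b)
  have hE : Tendsto (fun q => Real.exp (s q * (Real.log (u q) - Real.log a) +
      (1 - s q) * (Real.log (v q) - Real.log b)) - 1) l (𝓝 0) := by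
    have h := ((hbd hs1 hlu).add (hbd hs2 hlv)).rexp.sub_const 1
    simpa using h
  -- Dividing by `a + b` makes the geometric mean a coefficient in `[0,1]`, so `hbd` applies to it.
  have hG : Tendsto (fun q => (a + b) * (((a ^ s q * b ^ (1 - s q)) / (a + b)) *
      (Real.exp (s q * (Real.log (u q) - Real.log a) +
      (1 - s q) * (Real.log (v q) - Real.log b)) - 1))) l (𝓝 0) := by
    have h := (hbd (r := fun q => (a ^ s q * b ^ (1 - s q)) / (a + b)) ?_ hE).const_mul (a + b)
    · simpa using h
    · filter_upwards [hs] with q hq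
      rw [abs_of_nonneg (by positivity), div_le_one (by positivity)]
      have := meanGap_nonneg hq ha.le hb.le
      unfold meanGap at this
      nlinarith [hq.1, hq.2]
  have h := ((hbd hs1 hu0).add (hbd hs2 hv0)).sub hG
  simp only [add_zero, sub_zero] at h
  refine h.congr' ?_
  filter_upwards [hu.eventually (lt_mem_nhds ha), hv.eventually (lt_mem_nhds hb)] with q h1 h2
  have e : u q ^ s q * v q ^ (1 - s q) = a ^ s q * b ^ (1 - s q) *
      Real.exp (s q * (Real.log (u q) - Real.log a) +
      (1 - s q) * (Real.log (v q) - Real.log b)) := by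
    rw [Real.rpow_def_of_pos h1, Real.rpow_def_of_pos h2, Real.rpow_def_of_pos ha,
      Real.rpow_def_of_pos hb, ← Real.exp_add, ← Real.exp_add, ← Real.exp_add]
    congr 1; ring
  unfold meanGap
  rw [e]
  field_simp
  ring

/-! ### Taylor estimates -/

/-- One integration step with a monomial bound. Iterating it yields Taylor estimates whose
hypotheses are only pointwise bounds on the last derivative. -/
lemma abs_sub_le_of_abs_deriv_le {φ φ' : ℝ → ℝ} {ε M : ℝ} {k : ℕ}
    (hφ : ∀ t ∈ Icc 0 ε, HasDerivAt φ (φ' t) t)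
    (hM : ∀ t ∈ Icc 0 ε, |φ' t| ≤ M * t ^ k) {t : ℝ} (ht : t ∈ Icc 0 ε) :
    |φ t - φ 0| ≤ M / (k + 1) * t ^ (k + 1) := by
  have hk : (k : ℝ) + 1 ≠ 0 := by positivity
  have := image_norm_le_of_norm_deriv_right_le_deriv_boundary (f := fun t => φ t - φ 0)
    (f' := φ') (a := 0) (b := ε) (B := fun t => M / (k + 1) * t ^ (k + 1))
    (B' := fun t => M * t ^ k)
    (fun t ht => ((hφ t ht).continuousAt.sub continuousAt_const).continuousWithinAt)
    (fun t ht => ((hφ t ⟨ht.1, ht.2.le⟩).sub_const _).hasDerivWithinAt)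
    (by simp)
    (fun t => by
      have h := (hasDerivAt_pow (k + 1) t).const_mul (M / (k + 1))
      convert! h using 1
      push_cast; field_simp)
    (fun t ht => hM t ⟨ht.1, ht.2.le⟩)
  exact this ht

lemma abs_le_of_second_deriv {φ φ1 φ2 : ℝ → ℝ} {ε M : ℝ}
    (h0 : φ 0 = 0) (h1 : φ1 0 = 0)
    (hφ : ∀ t ∈ Icc 0 ε, HasDerivAt φ (φ1 t) t) (hφ1 : ∀ t ∈ Icc 0 ε, HasDerivAt φ1 (φ2 t) t)
    (hM : ∀ t ∈ Icc 0 ε, |φ2 t| ≤ M) {t : ℝ} (ht : t ∈ Icc 0 ε) : |φ t| ≤ M / 2 * t ^ 2 := by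
  have a1 : ∀ t ∈ Icc 0 ε, |φ1 t| ≤ M * t ^ 1 := fun t ht => by
    simpa [h1] using abs_sub_le_of_abs_deriv_le (k := 0) (M := M) hφ1 (by simpa using hM) ht
  have := abs_sub_le_of_abs_deriv_le hφ a1 ht
  norm_num [h0] at this ⊢
  exact this

lemma abs_sub_le_of_third_deriv {φ φ1 φ2 φ3 : ℝ → ℝ} {ε M : ℝ}
    (h0 : φ 0 = 0) (h1 : φ1 0 = 0)
    (hφ : ∀ t ∈ Icc 0 ε, HasDerivAt φ (φ1 t) t) (hφ1 : ∀ t ∈ Icc 0 ε, HasDerivAt φ1 (φ2 t) t)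
    (hφ2 : ∀ t ∈ Icc 0 ε, HasDerivAt φ2 (φ3 t) t)
    (hM : ∀ t ∈ Icc 0 ε, |φ3 t| ≤ M) {t : ℝ} (ht : t ∈ Icc 0 ε) :
    |φ t - φ2 0 / 2 * t ^ 2| ≤ M / 6 * t ^ 3 := by
  have a2 : ∀ t ∈ Icc 0 ε, |φ2 t - φ2 0| ≤ M * t ^ 1 := fun t ht => by
    simpa using abs_sub_le_of_abs_deriv_le (k := 0) (M := M) hφ2 (by simpa using hM) ht
  have a1 : ∀ t ∈ Icc 0 ε, |φ1 t - φ2 0 * t| ≤ M / 2 * t ^ 2 := fun t ht => by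
    have := abs_sub_le_of_abs_deriv_le (φ := fun t => φ1 t - φ2 0 * t) (ε := ε)
      (fun t ht => (hφ1 t ht).sub (by simpa using (hasDerivAt_id t).const_mul (φ2 0))) a2 ht
    norm_num [h1] at this ⊢
    exact this
  have := abs_sub_le_of_abs_deriv_le (φ := fun t => φ t - φ2 0 / 2 * t ^ 2) (ε := ε)
      (fun t ht => (hφ t ht).sub (g' := φ2 0 * t) (by
        have h := (hasDerivAt_pow 2 t).const_mul (φ2 0 / 2)
        convert! h using 1
        push_cast; ring)) a1 ht
  norm_num [h0] at this ⊢
  refine this.trans_eq ?_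
  ring

/-- The function `t ↦ meanGap s (1 + t) 1` vanishes to second order at `0` with second derivative
`s(1-s)`. Its third derivative is at most `2` in absolute value for `t ≥ 0`, uniformly in `s`, and
`2/6 ≤ 1`. -/
lemma abs_meanGap_one_add_sub_le {s r : ℝ} (hs : s ∈ Ioo (0 : ℝ) 1) (hr : 0 ≤ r) :
    |meanGap s (1 + r) 1 - s * (1 - s) / 2 * r ^ 2| ≤ r ^ 3 := by
  obtain ⟨hs0, hs1⟩ := hs
  have hd : ∀ p : ℝ, ∀ t ∈ Icc 0 r, HasDerivAt (fun t : ℝ => (1 + t) ^ p) (p * (1 + t) ^ (p - 1)) t := by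
    intro p t ht
    have h := ((hasDerivAt_id t).const_add 1).rpow_const (p := p)
      (Or.inl (by simp only [id]; linarith [ht.1]))
    convert! h using 1
    simp
  have key := abs_sub_le_of_third_deriv (φ := fun t => meanGap s (1 + t) 1)
    (φ1 := fun t => s - s * (1 + t) ^ (s - 1))
    (φ2 := fun t => - (s * ((s - 1) * (1 + t) ^ (s - 1 - 1))))
    (φ3 := fun t => - (s * ((s - 1) * ((s - 1 - 1) * (1 + t) ^ (s - 1 - 1 - 1)))))
    (ε := r) (M := 2) (by simp [meanGap]) (by simp) ?_ ?_ ?_ ?_ (t := r) ⟨hr, le_rfl⟩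
  · refine (le_of_eq ?_).trans (key.trans ?_)
    · simp only [add_zero, Real.one_rpow]; congr 1; ring
    · nlinarith [pow_nonneg hr 3]
  · intro t ht
    have h := ((((hasDerivAt_id t).const_add 1).const_mul s).add_const ((1 - s) * 1)).sub (hd s t ht)
    convert! h using 1
    · ext t; simp [meanGap]
    · simp
  · intro t ht
    have h := ((hd (s - 1) t ht).const_mul s).const_sub s
    exact h
  · intro t ht
    exact (((hd (s - 1 - 1) t ht).const_mul (s - 1)).const_mul s).neg
  · intro t ht
    have h1 : (1 + t) ^ (s - 1 - 1 - 1) ≤ 1 :=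
      Real.rpow_le_one_of_one_le_of_nonpos (by linarith [ht.1]) (by linarith)
    have h2 : 0 ≤ (1 + t) ^ (s - 1 - 1 - 1) := Real.rpow_nonneg (by linarith [ht.1]) _
    rw [show -(s * ((s - 1) * ((s - 1 - 1) * (1 + t) ^ (s - 1 - 1 - 1)))) =
      -((s * (1 - s) * (2 - s)) * (1 + t) ^ (s - 1 - 1 - 1)) by ring, abs_neg, abs_mul,
      abs_of_nonneg h2, abs_of_nonneg (by
        exact mul_nonneg (mul_nonneg hs0.le (by linarith)) (by linarith))]
    have : s * (1 - s) * (2 - s) ≤ 2 := by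
      nlinarith [mul_nonneg hs0.le (sub_nonneg.2 hs1.le)]
    nlinarith [mul_nonneg (mul_nonneg hs0.le (sub_nonneg.2 hs1.le)) (by linarith : 0 ≤ 2 - s)]

/-! ### Integrability of means of densities -/

lemma integrable_geom_mean {s : ℝ} (hs : s ∈ Ioo (0 : ℝ) 1) {p q : ℝ → ℝ} (hp : Integrable p)
    (hq : Integrable q) (hp0 : ∀ x, 0 ≤ p x) (hq0 : ∀ x, 0 ≤ q x) :
    Integrable fun x => p x ^ s * q x ^ (1 - s) := by
  refine (((hp.const_mul s).add (hq.const_mul (1 - s)))).mono'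
    ((hp.aemeasurable.pow_const s).mul (hq.aemeasurable.pow_const (1 - s))).aestronglyMeasurable
    (Eventually.of_forall fun x => ?_)
  have h1 := hp0 x
  have h2 := hq0 x
  have := meanGap_nonneg hs h1 h2
  rw [Real.norm_of_nonneg (by positivity)]
  simp only [meanGap, Pi.add_apply] at this ⊢
  linarith

lemma integrable_meanGap {s : ℝ} (hs : s ∈ Ioo (0 : ℝ) 1) {p q : ℝ → ℝ} (hp : Integrable p)
    (hq : Integrable q) (hp0 : ∀ x, 0 ≤ p x) (hq0 : ∀ x, 0 ≤ q x) :
    Integrable fun x => meanGap s (p x) (q x) :=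
  ((hp.const_mul s).add (hq.const_mul (1 - s))).sub (integrable_geom_mean hs hp hq hp0 hq0)

/-! ### Derivatives on the half-line -/

namespace HalfLine

variable {f : ℝ → ℝ}

lemma contDiffOn_deriv (hf : ContDiffOn ℝ 3 f (Ioi 0)) : ContDiffOn ℝ 2 (deriv f) (Ioi 0) :=
  hf.deriv_of_isOpen isOpen_Ioi (by norm_num)

lemma contDiffOn_deriv2 (hf : ContDiffOn ℝ 3 f (Ioi 0)) :
    ContDiffOn ℝ 1 (iteratedDeriv 2 f) (Ioi 0) := by
  rw [iteratedDeriv_succ, iteratedDeriv_one]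
  exact (contDiffOn_deriv hf).deriv_of_isOpen isOpen_Ioi (by norm_num)

lemma continuousOn_deriv3 (hf : ContDiffOn ℝ 3 f (Ioi 0)) :
    ContinuousOn (iteratedDeriv 3 f) (Ioi 0) := by
  rw [iteratedDeriv_succ]
  exact ((contDiffOn_deriv2 hf).deriv_of_isOpen (m := 0) isOpen_Ioi (by norm_num)).continuousOn

lemma hasDerivAt (hf : ContDiffOn ℝ 3 f (Ioi 0)) {x : ℝ} (hx : 0 < x) :
    HasDerivAt f (deriv f x) x :=
  ((hf.differentiableOn (by norm_num)).differentiableAt (Ioi_mem_nhds hx)).hasDerivAt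

lemma hasDerivAt_deriv (hf : ContDiffOn ℝ 3 f (Ioi 0)) {x : ℝ} (hx : 0 < x) :
    HasDerivAt (deriv f) (iteratedDeriv 2 f x) x := by
  rw [iteratedDeriv_succ, iteratedDeriv_one]
  exact (((contDiffOn_deriv hf).differentiableOn (by norm_num)).differentiableAt
    (Ioi_mem_nhds hx)).hasDerivAt

lemma hasDerivAt_deriv2 (hf : ContDiffOn ℝ 3 f (Ioi 0)) {x : ℝ} (hx : 0 < x) :
    HasDerivAt (iteratedDeriv 2 f) (iteratedDeriv 3 f x) x := by
  rw [iteratedDeriv_succ (n := 2)]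
  exact (((contDiffOn_deriv2 hf).differentiableOn (by norm_num)).differentiableAt
    (Ioi_mem_nhds hx)).hasDerivAt

end HalfLine

/-! ### The gap away from the endpoint -/

open HalfLine

/-- Third order Taylor estimate for the gap between the means of `f (x + ε)` and `f x`. -/
lemma abs_meanGap_shift_sub_le {f : ℝ → ℝ} (hf : ContDiffOn ℝ 3 f (Ioi 0))
    (hpos : ∀ x, 0 < x → 0 < f x) {s x ε S H₁ H₂ H₃ : ℝ} (hs : s ∈ Ioo (0 : ℝ) 1) (hx : 0 < x)
    (hε : 0 ≤ ε) (hS : ∀ t ∈ Icc 0 ε, f (x + t) ≤ S)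
    (h₁ : ∀ t ∈ Icc 0 ε, |(f (x + t) ^ 3)⁻¹ * deriv f (x + t) ^ 3| ≤ H₁)
    (h₂ : ∀ t ∈ Icc 0 ε, |(f (x + t) ^ 2)⁻¹ * deriv f (x + t) * iteratedDeriv 2 f (x + t)| ≤ H₂)
    (h₃ : ∀ t ∈ Icc 0 ε, |(f (x + t))⁻¹ * iteratedDeriv 3 f (x + t)| ≤ H₃) :
    |meanGap s (f (x + ε)) (f x) - s * (1 - s) / 2 * ε ^ 2 * ((f x)⁻¹ * deriv f x ^ 2)| ≤
      S * (2 * H₁ + 3 * H₂ + 2 * H₃) * ε ^ 3 := by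
  obtain ⟨hs0, hs1⟩ := id hs
  have hfx := hpos x hx
  set B := f x ^ (1 - s) with hB
  have hd0 : ∀ t ∈ Icc 0 ε, HasDerivAt (fun t => f (x + t)) (deriv f (x + t)) t := fun t ht => by
    simpa using (hasDerivAt hf (by linarith [ht.1] : 0 < x + t)).comp_const_add x t
  have hd1 : ∀ t ∈ Icc 0 ε, HasDerivAt (fun t => deriv f (x + t)) (iteratedDeriv 2 f (x + t)) t :=
    fun t ht => (hasDerivAt_deriv hf (by linarith [ht.1] : 0 < x + t)).comp_const_add x t
  have hd2 : ∀ t ∈ Icc 0 ε, HasDerivAt (fun t => iteratedDeriv 2 f (x + t))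
      (iteratedDeriv 3 f (x + t)) t :=
    fun t ht => (hasDerivAt_deriv2 hf (by linarith [ht.1] : 0 < x + t)).comp_const_add x t
  have hdp : ∀ p : ℝ, ∀ t ∈ Icc 0 ε, HasDerivAt (fun t => f (x + t) ^ p)
      (deriv f (x + t) * p * f (x + t) ^ (p - 1)) t := fun p t ht =>
    (hd0 t ht).rpow_const (Or.inl (hpos _ (by linarith [ht.1])).ne')
  have hft : ∀ t ∈ Icc 0 ε, 0 < f (x + t) := fun t ht => hpos _ (by linarith [ht.1])
  have h0mem : (0 : ℝ) ∈ Icc 0 ε := ⟨le_rfl, hε⟩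
  have hBx : f x ^ (s - 1) * B = 1 := by
    rw [hB, ← Real.rpow_add hfx]; simp
  have hBx2 : f x ^ (s - 1 - 1) * B = (f x)⁻¹ := by
    rw [hB, ← Real.rpow_add hfx, ← Real.rpow_neg_one]; ring_nf
  -- In the second derivative at `t = 0` the terms with `f''` cancel, which leaves `s(1-s) (f')²/f`.
  -- The factor `1/6` of the remainder is simply dropped.
  have key := abs_sub_le_of_third_deriv (ε := ε) (t := ε) (M := S * (2 * H₁ + 3 * H₂ + 2 * H₃))
    (φ := fun t => meanGap s (f (x + t)) (f x))
    (φ1 := fun t => s * deriv f (x + t) - s * B * (f (x + t) ^ (s - 1) * deriv f (x + t)))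
    (φ2 := fun t => s * iteratedDeriv 2 f (x + t) - s * B *
      ((s - 1) * f (x + t) ^ (s - 1 - 1) * deriv f (x + t) ^ 2 +
        f (x + t) ^ (s - 1) * iteratedDeriv 2 f (x + t)))
    (φ3 := fun t => s * iteratedDeriv 3 f (x + t) - s * B *
      ((s - 1) * (s - 1 - 1) * f (x + t) ^ (s - 1 - 1 - 1) * deriv f (x + t) ^ 3 +
        3 * (s - 1) * f (x + t) ^ (s - 1 - 1) * deriv f (x + t) * iteratedDeriv 2 f (x + t) +
        f (x + t) ^ (s - 1) * iteratedDeriv 3 f (x + t)))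
    ?_ ?_ ?_ ?_ ?_ ?_ ⟨hε, le_rfl⟩
  · have e : (s * iteratedDeriv 2 f (x + 0) - s * B *
      ((s - 1) * f (x + 0) ^ (s - 1 - 1) * deriv f (x + 0) ^ 2 +
        f (x + 0) ^ (s - 1) * iteratedDeriv 2 f (x + 0))) / 2 * ε ^ 2 =
        s * (1 - s) / 2 * ε ^ 2 * ((f x)⁻¹ * deriv f x ^ 2) := by
      rw [add_zero, ← hBx2]
      linear_combination (- s * iteratedDeriv 2 f x / 2 * ε ^ 2) * hBx
    simp only [e] at key
    refine key.trans ?_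
    have hS0 : 0 ≤ S := (hft 0 h0mem).le.trans (hS 0 h0mem)
    have := (abs_nonneg _).trans (h₁ 0 h0mem)
    have := (abs_nonneg _).trans (h₂ 0 h0mem)
    have := (abs_nonneg _).trans (h₃ 0 h0mem)
    have : 0 ≤ S * (2 * H₁ + 3 * H₂ + 2 * H₃) * ε ^ 3 := by positivity
    linarith
  · have : f x ^ s * f x ^ (1 - s) = f x := by
      rw [← Real.rpow_add hfx]; simp
    simp only [meanGap, add_zero, this]; ring
  · simp only [add_zero]; linear_combination (- s * deriv f x) * hBx
  · intro t ht
    have h := (((hd0 t ht).const_mul s).add_const ((1 - s) * f x)).sub ((hdp s t ht).mul_const B)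
    convert! h using 1
    ring
  · intro t ht
    have h := ((hd1 t ht).const_mul s).sub (((hdp (s - 1) t ht).mul (hd1 t ht)).const_mul (s * B))
    convert! h using 1
    ring
  · intro t ht
    have h := ((hd2 t ht).const_mul s).sub (((((hdp (s - 1 - 1) t ht).const_mul (s - 1)).mul
      ((hd1 t ht).pow 2)).add ((hdp (s - 1) t ht).mul (hd2 t ht))).const_mul (s * B))
    convert! h using 1
    simp only [Pi.pow_apply]; push_cast; ring
  · intro t ht
    have hy := hft t ht
    set y := f (x + t)
    have e1 : y ^ (s - 1) = y ^ s * y⁻¹ := by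
      rw [Real.rpow_sub hy, Real.rpow_one]; rfl
    have e2 : y ^ (s - 1 - 1) = y ^ s * (y ^ 2)⁻¹ := by
      rw [Real.rpow_sub hy, Real.rpow_sub hy, Real.rpow_one]; field_simp
    have e3 : y ^ (s - 1 - 1 - 1) = y ^ s * (y ^ 3)⁻¹ := by
      rw [Real.rpow_sub hy, Real.rpow_sub hy, Real.rpow_sub hy, Real.rpow_one]; field_simp
    -- After factoring out `y^s * B`, a geometric mean of two values of `f`, the third derivative
    -- contains only the three quotients controlled by the tail condition.
    have hG : y ^ s * B ≤ S := by
      have := meanGap_nonneg hs hy.le hfx.le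
      have a1 := hS t ht
      have a2 := hS 0 h0mem
      rw [add_zero] at a2
      simp only [meanGap] at this
      nlinarith
    have hG0 : 0 ≤ y ^ s * B := by positivity
    have b1 := h₁ t ht
    have b2 := h₂ t ht
    have b3 := h₃ t ht
    have hyS := hS t ht
    set g1 := (y ^ 3)⁻¹ * deriv f (x + t) ^ 3
    set g2 := (y ^ 2)⁻¹ * deriv f (x + t) * iteratedDeriv 2 f (x + t)
    set g3 := y⁻¹ * iteratedDeriv 3 f (x + t) with hg3
    have e4 : iteratedDeriv 3 f (x + t) = y * g3 := by rw [hg3]; field_simp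
    have e : s * iteratedDeriv 3 f (x + t) - s * B *
      ((s - 1) * (s - 1 - 1) * y ^ (s - 1 - 1 - 1) * deriv f (x + t) ^ 3 +
        3 * (s - 1) * y ^ (s - 1 - 1) * deriv f (x + t) * iteratedDeriv 2 f (x + t) +
        y ^ (s - 1) * iteratedDeriv 3 f (x + t)) =
        s * (y * g3) - s * ((y ^ s * B) * ((1 - s) * (2 - s) * g1 - 3 * (1 - s) * g2 + g3)) := by
      rw [e1, e2, e3, ← e4]; simp only [g1, g2, g3]; ring
    rw [e]
    have c3 : |y * g3| ≤ S * H₃ := by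
      rw [abs_mul, abs_of_pos hy]
      exact mul_le_mul hyS b3 (abs_nonneg _) (hy.le.trans hyS)
    have c : |(1 - s) * (2 - s) * g1 - 3 * (1 - s) * g2 + g3| ≤ 2 * H₁ + 3 * H₂ + H₃ := by
      have d1 : |(1 - s) * (2 - s) * g1| ≤ 2 * H₁ := by
        rw [abs_mul, abs_of_nonneg (mul_nonneg (by linarith) (by linarith))]
        exact mul_le_mul (by nlinarith) b1 (abs_nonneg _) (by norm_num)
      have d2 : |3 * (1 - s) * g2| ≤ 3 * H₂ := by
        rw [abs_mul, abs_of_nonneg (by linarith)]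
        exact mul_le_mul (by linarith) b2 (abs_nonneg _) (by norm_num)
      exact (abs_add_le _ _).trans (add_le_add ((abs_sub _ _).trans (add_le_add d1 d2)) b3)
    have c' : |(y ^ s * B) * ((1 - s) * (2 - s) * g1 - 3 * (1 - s) * g2 + g3)| ≤
        S * (2 * H₁ + 3 * H₂ + H₃) := by
      rw [abs_mul, abs_of_nonneg hG0]
      exact mul_le_mul hG c (abs_nonneg _) (hy.le.trans hyS)
    have hm : ∀ {z Z : ℝ}, |z| ≤ Z → |s * z| ≤ Z := fun hz => by
      rw [abs_mul, abs_of_pos hs0]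
      exact (mul_le_of_le_one_left (abs_nonneg _) hs1.le).trans hz
    refine (abs_sub _ _).trans ((add_le_add (hm c3) (hm c')).trans_eq ?_)
    ring

lemma le_supShift {g : ℝ → ℝ} (hg : ContinuousOn g (Ioi 0)) {δ x t : ℝ} (hx : 0 < x)
    (ht : t ∈ Icc 0 δ) : g (x + t) ≤ supShift δ g x := by
  have hc : ContinuousOn (fun t => g (x + t)) (Icc 0 δ) :=
    hg.comp (by fun_prop) fun t ht => show 0 < x + t by linarith [ht.1]
  have hb : BddAbove (range fun t : Icc (0 : ℝ) δ => g (x + t)) := by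
    refine (isCompact_Icc.image_of_continuousOn hc).bddAbove.mono ?_
    rintro _ ⟨t, rfl⟩
    exact ⟨t, t.2, rfl⟩
  exact le_ciSup hb ⟨t, ht⟩

lemma exists_bound_Icc {g : ℝ → ℝ} (hg : ContinuousOn g (Ioi 0)) {a b : ℝ} (ha : 0 < a) :
    ∃ M, ∀ x ∈ Icc a b, |g x| ≤ M :=
  isCompact_Icc.exists_bound_of_continuousOn (hg.mono fun _ hx => ha.trans_le hx.1)

/-- Away from the endpoint the gap integral is quadratic in the shift, up to a cubic error which
is uniform in `s`. -/
lemma exists_tail_bound {f : ℝ → ℝ} (hd : IsHalfLineDensity f) (ht : TailCondition f) {η : ℝ}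
    (hη : 0 < η) :
    IntegrableOn (fun x => (f x)⁻¹ * deriv f x ^ 2) (Ioi η) ∧
    ∃ C δ : ℝ, 0 < δ ∧ 0 ≤ C ∧ ∀ ε ∈ Ioc 0 δ, ∀ s ∈ Ioo (0 : ℝ) 1,
      |(∫ x in Ioi η, meanGap s (f (x + ε)) (f x)) -
        s * (1 - s) / 2 * ε ^ 2 * ∫ x in Ioi η, (f x)⁻¹ * deriv f x ^ 2| ≤ C * ε ^ 3 := by
  obtain ⟨c₀, hc₀, δ, hδ, hJ, hI1, hI2, hI3⟩ := ht
  have hf := hd.contDiffOn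
  have hcf := hf.continuousOn
  have hcf1 := (contDiffOn_deriv hf).continuousOn
  have hcf2 := (contDiffOn_deriv2 hf).continuousOn
  have hcf3 := continuousOn_deriv3 hf
  have hne : ∀ x ∈ Ioi (0 : ℝ), f x ≠ 0 := fun x hx => (hd.pos x hx).ne'
  have hcJ : ContinuousOn (fun x => (f x)⁻¹ * deriv f x ^ 2) (Ioi 0) :=
    (hcf.inv₀ hne).mul (hcf1.pow 2)
  have hc1 : ContinuousOn (fun y => |(f y ^ 3)⁻¹ * deriv f y ^ 3|) (Ioi 0) :=
    (((hcf.pow 3).inv₀ fun x hx => pow_ne_zero _ (hne x hx)).mul (hcf1.pow 3)).abs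
  have hc2 : ContinuousOn (fun y => |(f y ^ 2)⁻¹ * deriv f y * iteratedDeriv 2 f y|) (Ioi 0) :=
    ((((hcf.pow 2).inv₀ fun x hx => pow_ne_zero _ (hne x hx)).mul hcf1).mul hcf2).abs
  have hc3 : ContinuousOn (fun y => |(f y)⁻¹ * iteratedDeriv 3 f y|) (Ioi 0) :=
    ((hcf.inv₀ hne).mul hcf3).abs
  -- The tail condition only speaks about `x > c₀`. The gap between `η` and `c` is bridged by
  -- compactness of `[η, c + δ]`, on which all quotients are bounded.
  set c := max c₀ η with hc
  have hηc : η ≤ c := le_max_right _ _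
  have hsub : Ioi c ⊆ Ioi c₀ := Ioi_subset_Ioi (le_max_left _ _)
  have hu : Ioi η = Ioc η c ∪ Ioi c := (Ioc_union_Ioi_eq_Ioi hηc).symm
  have hJη : IntegrableOn (fun x => (f x)⁻¹ * deriv f x ^ 2) (Ioi η) := by
    rw [hu]
    refine IntegrableOn.union ?_ (hJ.mono_set hsub)
    exact ((hcJ.mono fun x (hx : x ∈ Icc η c) => hη.trans_le hx.1).integrableOn_Icc).mono_set
      Ioc_subset_Icc_self
  refine ⟨hJη, ?_⟩
  obtain ⟨M0, hM0⟩ := exists_bound_Icc hcf (b := c + δ) hη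
  obtain ⟨M1, hM1⟩ := exists_bound_Icc hc1 (b := c + δ) hη
  obtain ⟨M2, hM2⟩ := exists_bound_Icc hc2 (b := c + δ) hη
  obtain ⟨M3, hM3⟩ := exists_bound_Icc hc3 (b := c + δ) hη
  set W : ℝ → ℝ := fun x => if x ≤ c then M0 * (2 * M1 + 3 * M2 + 2 * M3) else
    supShift δ f x * (2 * supShift δ (fun y => |(f y ^ 3)⁻¹ * deriv f y ^ 3|) x +
      3 * supShift δ (fun y => |(f y ^ 2)⁻¹ * deriv f y * iteratedDeriv 2 f y|) x +
      2 * supShift δ (fun y => |(f y)⁻¹ * iteratedDeriv 3 f y|) x) with hW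
  have hWint : IntegrableOn W (Ioi η) := by
    rw [hu]
    refine IntegrableOn.union ?_ ?_
    · refine IntegrableOn.congr_fun (f := fun _ => M0 * (2 * M1 + 3 * M2 + 2 * M3)) ?_ ?_
        measurableSet_Ioc
      · exact integrableOn_const (by simp)
      · intro x hx
        simp only [hW, if_pos hx.2]
    · refine IntegrableOn.congr_fun (((hI1.mono_set hsub).const_mul 2).add
        ((hI2.mono_set hsub).const_mul 3) |>.add ((hI3.mono_set hsub).const_mul 2)) ?_
        measurableSet_Ioi
      intro x hx
      simp only [hW, if_neg (not_le.2 (mem_Ioi.1 hx)), Pi.add_apply]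
      ring
  refine ⟨|∫ x in Ioi η, W x|, δ, hδ, abs_nonneg _, fun ε hε s hs => ?_⟩
  have hgi : IntegrableOn (fun x => meanGap s (f (x + ε)) (f x)) (Ioi η) :=
    (integrable_meanGap hs (hd.integrable.comp_add_right ε) hd.integrable
      (fun x => hd.nonneg _) hd.nonneg).integrableOn
  rw [← integral_const_mul, ← integral_sub hgi (hJη.const_mul _)]
  refine (Real.norm_eq_abs _).symm.trans_le ((norm_integral_le_of_norm_le
    (hWint.mul_const (ε ^ 3)) ((ae_restrict_iff' measurableSet_Ioi).2
      (Eventually.of_forall fun x hx => ?_))).trans ?_)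
  · have hx' : 0 < x := hη.trans hx
    simp only [hW]
    have hsubt : ∀ t ∈ Icc 0 ε, t ∈ Icc 0 δ := fun t ht => ⟨ht.1, ht.2.trans hε.2⟩
    split_ifs with hxc
    · have hmem : ∀ t ∈ Icc 0 ε, x + t ∈ Icc η (c + δ) := fun t ht =>
        ⟨by linarith [ht.1, mem_Ioi.1 hx], by linarith [ht.2, hε.2]⟩
      exact abs_meanGap_shift_sub_le hf hd.pos hs hx' hε.1.le
        (fun t ht => (le_abs_self _).trans (hM0 _ (hmem t ht)))
        (fun t ht => (le_abs_self _).trans (hM1 _ (hmem t ht)))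
        (fun t ht => (le_abs_self _).trans (hM2 _ (hmem t ht)))
        (fun t ht => (le_abs_self _).trans (hM3 _ (hmem t ht)))
    · exact abs_meanGap_shift_sub_le hf hd.pos hs hx' hε.1.le
        (fun t ht => le_supShift hcf hx' (hsubt t ht))
        (fun t ht => le_supShift hc1 hx' (hsubt t ht))
        (fun t ht => le_supShift hc2 hx' (hsubt t ht))
        (fun t ht => le_supShift hc3 hx' (hsubt t ht))
  · rw [integral_mul_const]
    exact mul_le_mul_of_nonneg_right (le_abs_self _) (pow_nonneg hε.1.le 3)

/-! ### The deficit of the affinity -/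

/-- One minus the affinity `∫ f (x + ε)^s f(x)^(1-s)`, written as a sum of nonnegative terms. -/
noncomputable def deficit (f : ℝ → ℝ) (ε s : ℝ) : ℝ :=
  s * (∫ x in Ioc 0 ε, f x) + ∫ x in Ioi 0, meanGap s (f (x + ε)) (f x)

lemma IsHalfLineDensity.integral_Ioi {f : ℝ → ℝ} (hd : IsHalfLineDensity f) :
    ∫ x in Ioi 0, f x = 1 := by
  rw [← integral_Ici_eq_integral_Ioi, setIntegral_eq_integral_of_forall_compl_eq_zero,
    hd.integral_eq_one]
  intro x hx
  exact hd.eq_zero x (not_le.1 hx)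

lemma integrable_meanGap_shift {f : ℝ → ℝ} (hd : IsHalfLineDensity f) {s : ℝ}
    (hs : s ∈ Ioo (0 : ℝ) 1) (ε : ℝ) : Integrable fun x => meanGap s (f (x + ε)) (f x) :=
  integrable_meanGap hs (hd.integrable.comp_add_right ε) hd.integrable (fun _ => hd.nonneg _)
    hd.nonneg

/-- After translation only `x ≥ 0` contributes, since `f` vanishes to the left and `1 - s > 0`.
There `f (x + ε)` has mass `1` minus the mass of `(0, ε]`, which explains the first term of
`deficit`. -/
lemma integral_shift_rpow {f : ℝ → ℝ} (hd : IsHalfLineDensity f) (θ : ℝ) {ε s : ℝ} (hε : 0 < ε)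
    (hs : s ∈ Ioo (0 : ℝ) 1) :
    ∫ x, shift f θ x ^ s * shift f (θ + ε) x ^ (1 - s) = 1 - deficit f ε s := by
  have e1 : ∫ x, shift f θ x ^ s * shift f (θ + ε) x ^ (1 - s) =
      ∫ x, f (x + ε) ^ s * f x ^ (1 - s) := by
    rw [← integral_add_right_eq_self _ (θ + ε)]
    refine integral_congr_ae (Eventually.of_forall fun x => ?_)
    simp only [shift]
    ring_nf
  have e2 : ∫ x, f (x + ε) ^ s * f x ^ (1 - s) =
      ∫ x in Ioi 0, f (x + ε) ^ s * f x ^ (1 - s) := by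
    rw [← integral_Ici_eq_integral_Ioi, setIntegral_eq_integral_of_forall_compl_eq_zero]
    intro x hx
    rw [hd.eq_zero x (not_le.1 hx), Real.zero_rpow (by linarith [hs.2]), mul_zero]
  have hi := hd.integrable.comp_add_right ε
  have e3 : ∫ x in Ioi 0, f (x + ε) = 1 - ∫ x in Ioc 0 ε, f x := by
    have h1 : ∫ x in Ioi 0, f (x + ε) = ∫ x in Ioi ε, f x := by
      have := (measurePreserving_add_right volume ε).setIntegral_preimage_emb
        (measurableEmbedding_addRight ε) f (Ioi ε)
      simpa using this
    have h2 := setIntegral_union (μ := volume) (f := f) (Ioc_disjoint_Ioi_same (a := 0) (b := ε))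
      measurableSet_Ioi hd.integrable.integrableOn hd.integrable.integrableOn
    rw [Ioc_union_Ioi_eq_Ioi hε.le, hd.integral_Ioi] at h2
    linarith
  have e4 : ∫ x in Ioi 0, meanGap s (f (x + ε)) (f x) =
      s * (1 - ∫ x in Ioc 0 ε, f x) + (1 - s) * 1 - ∫ x in Ioi 0, f (x + ε) ^ s * f x ^ (1 - s) := by
    simp only [meanGap]
    rw [integral_sub, integral_add, integral_const_mul, integral_const_mul, e3, hd.integral_Ioi]
    · exact (hi.const_mul s).integrableOn
    · exact (hd.integrable.const_mul _).integrableOn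
    · exact ((hi.const_mul s).add (hd.integrable.const_mul _)).integrableOn
    · exact (integrable_geom_mean hs hi hd.integrable (fun _ => hd.nonneg _) hd.nonneg).integrableOn
  rw [e1, e2, deficit, e4]
  ring

/-- Passage from the affinity deficit to the relative Rényi entropy. -/
lemma uniformLimit_of_tendsto_deficit {f : ℝ → ℝ} (hd : IsHalfLineDensity f) {φ L : ℝ → ℝ}
    (hφ : ∀ᶠ ε in 𝓝[>] (0 : ℝ), 0 < φ ε) (hφ0 : Tendsto φ (𝓝[>] 0) (𝓝 0)) {M : ℝ}
    (hL : ∀ s ∈ Ioo (0 : ℝ) 1, |L s| ≤ M)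
    (h : Tendsto (fun q : ℝ × ℝ => deficit f q.1 q.2 / φ q.1 - L q.2) shiftFilter (𝓝 0)) (θ : ℝ) :
    UniformLimit (fun ε s => relRenyi s (shift f θ) (shift f (θ + ε)) / φ ε) L := by
  rw [UniformLimit, Metric.tendstoUniformlyOn_iff]
  intro τ hτ
  have hM0 : 0 ≤ M := (abs_nonneg _).trans (hL (1 / 2) (by norm_num))
  have h1 : ∀ᶠ ε in 𝓝[>] (0 : ℝ), ∀ s ∈ Ioo (0 : ℝ) 1,
      |deficit f ε s / φ ε - L s| < min 1 (τ / 2) := by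
    have := h.eventually (Metric.ball_mem_nhds 0 (by positivity : 0 < min 1 (τ / 2)))
    rw [eventually_prod_principal_iff] at this
    simpa only [Metric.mem_ball, dist_zero_right, Real.norm_eq_abs] using this
  have h2 : Tendsto (fun ε => (M + 1) * φ ε) (𝓝[>] 0) (𝓝 0) := by simpa using hφ0.const_mul (M + 1)
  have h3 : Tendsto (fun ε => 2 * (M + 1) ^ 2 * φ ε) (𝓝[>] 0) (𝓝 0) := by
    simpa using hφ0.const_mul (2 * (M + 1) ^ 2)
  filter_upwards [h1, hφ, h2.eventually (gt_mem_nhds (by norm_num : (0 : ℝ) < 1 / 2)),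
    h3.eventually (gt_mem_nhds (by positivity : 0 < τ / 2)), self_mem_nhdsWithin]
    with ε a1 a2 a3 a4 a5 s hs
  have b1 := a1 s hs
  set u := deficit f ε s
  rw [dist_comm, Real.dist_eq, relRenyi, integral_shift_rpow hd θ a5 hs]
  have c1 : |u / φ ε| ≤ M + 1 := by
    have := abs_add_le (u / φ ε - L s) (L s)
    rw [sub_add_cancel] at this
    linarith [hL s hs, b1.trans_le (min_le_left _ _)]
  have c2 : |u| ≤ (M + 1) * φ ε := by
    rwa [abs_div, abs_of_pos a2, div_le_iff₀ a2] at c1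
  have c3 : |u| < 1 / 2 := c2.trans_lt a3
  -- The logarithmic series cut after one term: `|u + log (1 - u)| ≤ |u|² / (1 - |u|)`, hence at
  -- most `2 u²` for `|u| < 1/2`. The bound `M` on the limit makes `u` small uniformly in `s`.
  have c4 := Real.abs_log_sub_add_sum_range_le (x := u) (by linarith) 1
  simp only [Finset.range_one, Finset.sum_singleton, zero_add, pow_one, Nat.cast_zero, div_one] at c4
  have c5 : |u + Real.log (1 - u)| ≤ 2 * (M + 1) ^ 2 * φ ε * φ ε := by
    refine c4.trans ?_
    rw [div_le_iff₀ (by linarith)]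
    have := pow_le_pow_left₀ (abs_nonneg u) c2 2
    change |u| ^ 2 ≤ _
    nlinarith [mul_nonneg (sq_nonneg ((M + 1) * φ ε)) (by linarith : 0 ≤ 1 / 2 - |u|)]
  have e : -Real.log (1 - u) / φ ε - L s = (u / φ ε - L s) - (u + Real.log (1 - u)) / φ ε := by
    ring
  rw [e]
  have c6 : |(u + Real.log (1 - u)) / φ ε| ≤ 2 * (M + 1) ^ 2 * φ ε := by
    rwa [abs_div, abs_of_pos a2, div_le_iff₀ a2]
  linarith [abs_sub (u / φ ε - L s) ((u + Real.log (1 - u)) / φ ε), min_le_right 1 (τ / 2)]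

/-! ### Power asymptotics at the endpoint -/

lemma tendsto_rpow_nhdsGT_zero {p : ℝ} (hp : 0 < p) :
    Tendsto (fun x : ℝ => x ^ p) (𝓝[>] 0) (𝓝 0) := by
  have : Tendsto (fun x : ℝ => x ^ p) (𝓝 0) (𝓝 (0 ^ p)) :=
    (ContinuousAt.rpow_const continuousAt_id (Or.inr hp.le)).tendsto
  rw [Real.zero_rpow hp.ne'] at this
  exact this.mono_left nhdsWithin_le_nhds

/-- Turns asymptotic equivalence into an inequality on a fixed interval, the form that can be
integrated. -/
lemma exists_near_rpow {g : ℝ → ℝ} {B p : ℝ} (hg : g ~[𝓝[>] 0] fun x => B * x ^ p) {τ : ℝ}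
    (hτ : 0 < τ) : ∃ η, 0 < η ∧ ∀ x ∈ Ioo 0 η, |g x - B * x ^ p| ≤ τ * x ^ p := by
  have h1 : (fun x : ℝ => B * x ^ p) =O[𝓝[>] 0] fun x => x ^ p :=
    (isBigO_refl _ _).const_mul_left B
  have h2 := (hg.isLittleO.trans_isBigO h1).def hτ
  obtain ⟨η, hη, h⟩ := mem_nhdsGT_iff_exists_Ioo_subset.1 h2
  refine ⟨η, hη, fun x hx => ?_⟩
  have := h hx
  simpa [abs_of_pos (Real.rpow_pos_of_pos hx.1 p)] using this

lemma integrableOn_Ioc_rpow {p : ℝ} (hp : -1 < p) (η : ℝ) :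
    IntegrableOn (fun x : ℝ => x ^ p) (Ioc 0 η) := by
  rcases le_total 0 η with h | h
  · exact (intervalIntegrable_iff_integrableOn_Ioc_of_le h).1
      (intervalIntegral.intervalIntegrable_rpow' hp)
  · simp [Ioc_eq_empty_of_le h]

lemma integral_Ioc_rpow {p η : ℝ} (hp : -1 < p) (hη : 0 ≤ η) :
    ∫ x in Ioc 0 η, x ^ p = η ^ (p + 1) / (p + 1) := by
  rw [← intervalIntegral.integral_of_le hη, integral_rpow (Or.inl hp),
    Real.zero_rpow (by linarith), sub_zero]

/-- The mass near the endpoint. -/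
lemma tendsto_integral_Ioc_div {f : ℝ → ℝ} {A κ : ℝ} (hi : Integrable f) (hκ : 0 < κ)
    (hf : f ~[𝓝[>] 0] fun x => A * x ^ (κ - 1)) :
    Tendsto (fun ε => (∫ x in Ioc 0 ε, f x) / ε ^ κ) (𝓝[>] 0) (𝓝 (A / κ)) := by
  rw [Metric.tendsto_nhds]
  intro τ hτ
  obtain ⟨η, hη, h⟩ := exists_near_rpow hf (by positivity : 0 < τ * κ / 2)
  filter_upwards [Ioo_mem_nhdsGT hη] with ε hε
  have hεκ : 0 < ε ^ κ := Real.rpow_pos_of_pos hε.1 κ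
  have e : ∫ x in Ioc 0 ε, x ^ (κ - 1) = ε ^ κ / κ := by
    rw [integral_Ioc_rpow (by linarith) hε.1.le]; simp
  have hr := integrableOn_Ioc_rpow (by linarith : -1 < κ - 1) ε
  have key : |(∫ x in Ioc 0 ε, f x) - A * (ε ^ κ / κ)| ≤ τ * κ / 2 * (ε ^ κ / κ) := by
    rw [← e, ← integral_const_mul, ← integral_const_mul,
      ← integral_sub hi.integrableOn (hr.const_mul _)]
    refine (Real.norm_eq_abs _).symm.trans_le (norm_integral_le_of_norm_le (hr.const_mul _) ?_)
    exact (ae_restrict_iff' measurableSet_Ioc).2 (Eventually.of_forall fun x hx =>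
      h x ⟨hx.1, hx.2.trans_lt hε.2⟩)
  rw [Real.dist_eq]
  have e2 : (∫ x in Ioc 0 ε, f x) / ε ^ κ - A / κ =
      ((∫ x in Ioc 0 ε, f x) - A * (ε ^ κ / κ)) / ε ^ κ := by field_simp
  rw [e2, abs_div, abs_of_pos hεκ, div_lt_iff₀ hεκ]
  refine key.trans_lt ?_
  field_simp
  linarith

/-! ### Gap estimates from power bounds -/

/-- A majorant, up to a constant factor, of the gap between the means of `(y + 1)^p` and `y^p`. -/
noncomputable def scaleBound (p y : ℝ) : ℝ :=
  if y ≤ 1 then y ^ p + (y + 1) ^ p else y ^ (p - 2)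

lemma scaleBound_nonneg {p y : ℝ} (hy : 0 ≤ y) : 0 ≤ scaleBound p y := by
  unfold scaleBound; split_ifs <;> positivity

/-- On `[x, 2x]` all powers are comparable to their value at `x`; the exponent `|p|` treats both
signs of `p` together. -/
lemma rpow_le_two_rpow_abs_mul {p x z : ℝ} (hx : 0 < x) (h1 : x ≤ z) (h2 : z ≤ 2 * x) :
    z ^ p ≤ 2 ^ |p| * x ^ p := by
  have hz := hx.trans_le h1
  have h3 : (z / x) ^ p ≤ 2 ^ |p| := by
    calc (z / x) ^ p ≤ (z / x) ^ |p| :=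
          Real.rpow_le_rpow_of_exponent_le ((one_le_div hx).2 h1) (le_abs_self p)
      _ ≤ 2 ^ |p| := Real.rpow_le_rpow (by positivity) ((div_le_iff₀ hx).2 h2) (abs_nonneg p)
  rwa [Real.div_rpow hz.le hx.le, div_le_iff₀ (by positivity)] at h3

lemma rpow_le_two_rpow_abs_mul' {p x z : ℝ} (hx : 0 < x) (h1 : x ≤ z) (h2 : z ≤ 2 * x) :
    x ^ p ≤ 2 ^ |p| * z ^ p := by
  have hz := hx.trans_le h1
  have := rpow_le_two_rpow_abs_mul (p := -p) hx h1 h2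
  rw [abs_neg, Real.rpow_neg hz.le, Real.rpow_neg hx.le] at this
  have a := Real.rpow_pos_of_pos hx p
  have b := Real.rpow_pos_of_pos hz p
  field_simp at this
  linarith

/-- If `f` and `f'` are of the orders of `x^p` and `x^(p-1)`, the gap is controlled by
`scaleBound`. -/
lemma exists_meanGap_le_scaleBound (p : ℝ) {c C : ℝ} (hc : 0 < c) (hC : 0 < C) :
    ∃ K, 0 < K ∧ ∀ (f f' : ℝ → ℝ) (x ε s : ℝ), 0 < x → 0 < ε → s ∈ Ioo (0 : ℝ) 1 →
      (∀ z ∈ Icc x (x + ε), c * z ^ p ≤ f z ∧ f z ≤ C * z ^ p ∧ HasDerivAt f (f' z) z ∧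
        |f' z| ≤ C * z ^ (p - 1)) →
      meanGap s (f (x + ε)) (f x) ≤ K * (ε ^ p * scaleBound p (x / ε)) := by
  set D : ℝ := (C * 2 ^ |p - 1|) ^ 2 / (c / 2 ^ |p|) with hD
  have hD0 : 0 < D := by positivity
  refine ⟨C + D, by positivity, fun f f' x ε s hx hε hs h => ?_⟩
  have hmx : x ∈ Icc x (x + ε) := ⟨le_rfl, by linarith⟩
  have hmy : x + ε ∈ Icc x (x + ε) := ⟨by linarith, le_rfl⟩
  have hfp : ∀ z ∈ Icc x (x + ε), 0 < f z := fun z hz =>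
    (mul_pos hc (Real.rpow_pos_of_pos (hx.trans_le hz.1) p)).trans_le (h z hz).1
  have hε' : ε ^ p * (x / ε) ^ p = x ^ p := by
    rw [← Real.mul_rpow hε.le (by positivity)]; congr 1; field_simp
  have hε2 : ε ^ p * (x / ε + 1) ^ p = (x + ε) ^ p := by
    rw [← Real.mul_rpow hε.le (by positivity)]; congr 1; field_simp
  unfold scaleBound
  split_ifs with hxe
  -- For `x ≤ ε` the two values need not be comparable, so the gap is bounded by their sum. In the
  -- other case `[x, x + ε]` lies in `[x, 2x]`, and `meanGap_le_sq` with the mean value inequality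
  -- gives `ε² x^(p-2) = ε^p (x/ε)^(p-2)`.
  · rw [mul_add, hε', hε2]
    calc meanGap s (f (x + ε)) (f x) ≤ f (x + ε) + f x :=
          meanGap_le_add hs (hfp _ hmy).le (hfp _ hmx).le
      _ ≤ C * (x + ε) ^ p + C * x ^ p := add_le_add (h _ hmy).2.1 (h _ hmx).2.1
      _ = C * (x ^ p + (x + ε) ^ p) := by ring
      _ ≤ (C + D) * (x ^ p + (x + ε) ^ p) := by gcongr; linarith
  · have hxe' : ε ≤ x := by
      rw [not_le, one_lt_div hε] at hxe; exact hxe.le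
    have hz2 : ∀ z ∈ Icc x (x + ε), z ≤ 2 * x := fun z hz => by linarith [hz.2]
    have hm : ∀ z ∈ Icc x (x + ε), c / 2 ^ |p| * x ^ p ≤ f z := fun z hz => by
      refine le_trans ?_ (h z hz).1
      rw [div_mul_eq_mul_div, div_le_iff₀ (by positivity), mul_assoc]
      have := rpow_le_two_rpow_abs_mul' (p := p) hx hz.1 (hz2 z hz)
      gcongr
      linarith
    have hd : ∀ z ∈ Icc x (x + ε), |f' z| ≤ C * 2 ^ |p - 1| * x ^ (p - 1) := fun z hz => by
      refine (h z hz).2.2.2.trans ?_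
      rw [mul_assoc]
      gcongr
      exact rpow_le_two_rpow_abs_mul hx hz.1 (hz2 z hz)
    have hdiff : |f (x + ε) - f x| ≤ C * 2 ^ |p - 1| * x ^ (p - 1) * ε := by
      have := (convex_Icc x (x + ε)).norm_image_sub_le_of_norm_hasDerivWithin_le
        (fun z hz => (h z hz).2.2.1.hasDerivWithinAt) hd hmx hmy
      simpa [abs_of_pos hε] using this
    have hxp := Real.rpow_pos_of_pos hx p
    calc meanGap s (f (x + ε)) (f x) ≤ (f (x + ε) - f x) ^ 2 / (c / 2 ^ |p| * x ^ p) :=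
          meanGap_le_sq hs (by positivity) (hm _ hmy) (hm _ hmx)
      _ ≤ (C * 2 ^ |p - 1| * x ^ (p - 1) * ε) ^ 2 / (c / 2 ^ |p| * x ^ p) := by
          rw [← sq_abs (f (x + ε) - f x)]
          gcongr
      _ = D * (ε ^ p * (x / ε) ^ (p - 2)) := by
          have e1 : x ^ (p - 1) = x ^ p / x := by rw [Real.rpow_sub hx, Real.rpow_one]
          have e2 : (x / ε) ^ (p - 2) = (x / ε) ^ p / (x / ε) ^ 2 := by
            rw [Real.rpow_sub (by positivity)]; norm_num
          rw [e1, e2, hD]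
          rw [← hε']
          have : 0 < (x / ε) ^ p := by positivity
          have : 0 < ε ^ p := by positivity
          field_simp
      _ ≤ (C + D) * (ε ^ p * (x / ε) ^ (p - 2)) := by gcongr; linarith

lemma integrableOn_scaleBound_Ioc {p : ℝ} (hp : -1 < p) :
    IntegrableOn (scaleBound p) (Ioc 0 1) := by
  refine IntegrableOn.congr_fun (f := fun y => y ^ p + (y + 1) ^ p) ?_ ?_ measurableSet_Ioc
  · refine (integrableOn_Ioc_rpow hp 1).add ?_
    refine (ContinuousOn.integrableOn_Icc ?_).mono_set Ioc_subset_Icc_self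
    exact ContinuousOn.rpow_const (by fun_prop) fun x hx => Or.inl (by linarith [hx.1])
  · intro y hy
    simp [scaleBound, hy.2]

lemma scaleBound_of_one_lt {p y : ℝ} (hy : 1 < y) : scaleBound p y = y ^ (p - 2) := by
  simp [scaleBound, hy]

/-- Integrability at `0` needs `p > -1`, and at infinity `p - 2 < -1`. With `p = κ - 1` the second
condition is exactly `κ < 2`. -/
lemma integrableOn_scaleBound {p : ℝ} (hp : -1 < p) (hp1 : p < 1) :
    IntegrableOn (scaleBound p) (Ioi 0) := by
  rw [← Ioc_union_Ioi_eq_Ioi zero_le_one]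
  refine (integrableOn_scaleBound_Ioc hp).union ?_
  refine (integrableOn_Ioi_rpow_of_lt (by linarith : p - 2 < -1) one_pos).congr_fun ?_
    measurableSet_Ioi
  intro y hy
  exact (scaleBound_of_one_lt hy).symm

lemma integrableOn_scaleBound_Ioc' {p : ℝ} (hp : -1 < p) (R : ℝ) :
    IntegrableOn (scaleBound p) (Ioc 0 R) := by
  refine ((integrableOn_scaleBound_Ioc hp).union (t := Ioc 1 R) ?_).mono_set
    Ioc_subset_Ioc_union_Ioc
  refine IntegrableOn.congr_fun (f := fun y => y ^ (p - 2)) ?_ ?_ measurableSet_Ioc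
  · refine (ContinuousOn.integrableOn_Icc ?_).mono_set Ioc_subset_Icc_self
    exact ContinuousOn.rpow_const (by fun_prop) fun x hx => Or.inl (by linarith [hx.1])
  · intro y hy
    exact (scaleBound_of_one_lt hy.1).symm

/-! ### The limiting integral -/

lemma exists_meanGap_rpow_le (p : ℝ) : ∃ K, 0 < K ∧ ∀ y s : ℝ, 0 < y → s ∈ Ioo (0 : ℝ) 1 →
    meanGap s ((y + 1) ^ p) (y ^ p) ≤ K * scaleBound p y := by
  obtain ⟨K, hK, h⟩ := exists_meanGap_le_scaleBound p one_pos
    (by positivity : (0 : ℝ) < 1 + |p|)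
  refine ⟨K, hK, fun y s hy hs => ?_⟩
  have := h (fun z => z ^ p) (fun z => p * z ^ (p - 1)) y 1 s hy one_pos hs fun z hz => ?_
  · simpa using this
  · have hz0 := hy.trans_le hz.1
    have := Real.rpow_pos_of_pos hz0 p
    have := Real.rpow_pos_of_pos hz0 (p - 1)
    refine ⟨by simp, ?_, Real.hasDerivAt_rpow_const (Or.inl hz0.ne'), ?_⟩
    · nlinarith [mul_nonneg (abs_nonneg p) (Real.rpow_pos_of_pos hz0 p).le]
    · rw [abs_mul, abs_of_pos this]
      gcongr; linarith

lemma integrableOn_meanGap_rpow {p s : ℝ} (hp : -1 < p) (hp1 : p < 1) (hs : s ∈ Ioo (0 : ℝ) 1) :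
    IntegrableOn (fun y => meanGap s ((y + 1) ^ p) (y ^ p)) (Ioi 0) := by
  obtain ⟨K, hK, h⟩ := exists_meanGap_rpow_le p
  refine ((integrableOn_scaleBound hp hp1).const_mul K).mono'
    (Measurable.aestronglyMeasurable (by unfold meanGap; fun_prop)) ?_
  refine (ae_restrict_iff' measurableSet_Ioi).2 (Eventually.of_forall fun y (hy : 0 < y) => ?_)
  rw [Real.norm_of_nonneg (meanGap_nonneg hs (by positivity) (by positivity))]
  exact h y s hy hs

lemma integral_Ioo_eq_beta {a b : ℝ} (ha : 0 < a) (hb : 0 < b) :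
    ∫ x in Ioo (0 : ℝ) 1, x ^ (a - 1) * (1 - x) ^ (b - 1) = ProbabilityTheory.beta a b := by
  rw [ProbabilityTheory.beta_eq_betaIntegralReal a b ha hb, Complex.betaIntegral,
    intervalIntegral.integral_of_le (by norm_num), ← integral_Ioc_eq_integral_Ioo,
    ← RCLike.re_to_complex, ← integral_re]
  · refine setIntegral_congr_fun measurableSet_Ioc fun x ⟨hx1, hx₂⟩ ↦ ?_
    norm_cast
    rw [← Complex.ofReal_cpow, ← Complex.ofReal_cpow, RCLike.re_to_complex,
      Complex.re_mul_ofReal, Complex.ofReal_re]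
    all_goals linarith
  · have := Complex.betaIntegral_convergent (u := a) (v := b) (by simpa) (by simpa)
    rwa [intervalIntegrable_iff_integrableOn_Ioc_of_le zero_le_one] at this

/-- The substitution `y = t/(1-t)` maps `(0,1)` onto the half-line. -/
lemma integral_Ioi_eq_beta {a b : ℝ} (ha : 0 < a) (hb : 0 < b) :
    ∫ y in Ioi (0 : ℝ), y ^ (a - 1) * (1 + y) ^ (-(a + b)) = ProbabilityTheory.beta a b := by
  have himg : (fun t : ℝ => t / (1 - t)) '' Ioo 0 1 = Ioi 0 := by
    ext y
    constructor
    · rintro ⟨t, ht, rfl⟩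
      exact div_pos ht.1 (by linarith [ht.2])
    · intro hy
      have hy : 0 < y := hy
      exact ⟨y / (1 + y), ⟨by positivity, (div_lt_one (by positivity)).2 (by linarith)⟩, by
        field_simp; ring⟩
  have hder : ∀ t ∈ Ioo (0 : ℝ) 1,
      HasDerivWithinAt (fun t : ℝ => t / (1 - t)) (((1 - t) ^ 2)⁻¹) (Ioo 0 1) t := by
    intro t ht
    have h1 : 1 - t ≠ 0 := by linarith [ht.2]
    have h := (hasDerivAt_id t).div ((hasDerivAt_id t).const_sub 1) h1
    refine HasDerivAt.hasDerivWithinAt ?_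
    convert! h using 1
    simp only [id]; field_simp; ring
  have hinj : InjOn (fun t : ℝ => t / (1 - t)) (Ioo 0 1) := by
    intro t ht u hu h
    have h1 : 1 - t ≠ 0 := by linarith [ht.2]
    have h2 : 1 - u ≠ 0 := by linarith [hu.2]
    simp only at h
    rw [div_eq_div_iff h1 h2] at h
    linarith
  rw [← integral_Ioo_eq_beta ha hb, ← himg,
    integral_image_eq_integral_abs_deriv_smul measurableSet_Ioo hder hinj]
  refine setIntegral_congr_fun measurableSet_Ioo fun t ht => ?_
  have h1 : 0 < 1 - t := by linarith [ht.2]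
  have e1 : 1 + t / (1 - t) = (1 - t)⁻¹ := by field_simp; ring
  simp only [smul_eq_mul]
  rw [e1, abs_of_pos (by positivity), Real.div_rpow ht.1.le h1.le, Real.inv_rpow h1.le,
    Real.rpow_neg h1.le, inv_inv, div_eq_mul_inv, ← Real.rpow_neg h1.le]
  rw [show ((1 - t) ^ 2)⁻¹ = (1 - t) ^ (-2 : ℝ) by rw [Real.rpow_neg h1.le]; norm_num]
  calc (1 - t) ^ (-2 : ℝ) * (t ^ (a - 1) * (1 - t) ^ (-(a - 1)) * (1 - t) ^ (a + b))
      = t ^ (a - 1) * ((1 - t) ^ (-2 : ℝ) * (1 - t) ^ (-(a - 1)) * (1 - t) ^ (a + b)) := by ring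
    _ = t ^ (a - 1) * (1 - t) ^ (b - 1) := by
      rw [← Real.rpow_add h1, ← Real.rpow_add h1]; congr 2; ring

/-- The integral of a non-integrable function is `0` by convention, so a nonzero value proves
integrability. -/
lemma integrableOn_Ioi_beta {a b : ℝ} (ha : 0 < a) (hb : 0 < b) :
    IntegrableOn (fun y : ℝ => y ^ (a - 1) * (1 + y) ^ (-(a + b))) (Ioi 0) := by
  refine not_imp_comm.1 integral_undef ?_
  rw [integral_Ioi_eq_beta ha hb]
  exact (ProbabilityTheory.beta_pos ha hb).ne'

/-- With `t = 1/y` this is the behaviour at infinity of the antiderivative in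
`integral_meanGap_rpow`. The relation `r = s(κ-1)` is what makes the first order term at `t = 0`
vanish. -/
lemma exists_abs_combination_le (s κ r : ℝ) (hr : r = s * (κ - 1)) :
    ∃ M, ∀ t ∈ Icc (0 : ℝ) 1,
      |s * (1 + t) ^ κ + (1 - s) - (1 + t) ^ r - s * (t * (1 + t) ^ (r - 1))| ≤ M * t ^ 2 := by
  have hd : ∀ p : ℝ, ∀ t ∈ Icc (0 : ℝ) 1,
      HasDerivAt (fun t : ℝ => (1 + t) ^ p) (p * (1 + t) ^ (p - 1)) t := by
    intro p t ht
    have h := ((hasDerivAt_id t).const_add 1).rpow_const (p := p)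
      (Or.inl (by simp only [id]; linarith [ht.1]))
    convert! h using 1
    simp
  have hc : ∀ p : ℝ, ContinuousOn (fun t : ℝ => (1 + t) ^ p) (Icc 0 1) := fun p t ht =>
    (hd p t ht).continuousAt.continuousWithinAt
  set ψ2 : ℝ → ℝ := fun t => s * (κ * ((κ - 1) * (1 + t) ^ (κ - 1 - 1))) -
      (1 + s) * (r * ((r - 1) * (1 + t) ^ (r - 1 - 1))) +
      s * ((r - 1) * ((r - 1 - 1) * (1 + t) ^ (r - 1 - 1 - 1))) with hψ2
  obtain ⟨M, hM⟩ := isCompact_Icc.exists_bound_of_continuousOn (f := ψ2) (s := Icc 0 1) (by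
    have h1 := hc (κ - 1 - 1)
    have h2 := hc (r - 1 - 1)
    have h3 := hc (r - 1 - 1 - 1)
    fun_prop)
  refine ⟨M / 2, fun t ht => ?_⟩
  have e : s * (1 + t) ^ κ + (1 - s) - (1 + t) ^ r - s * (t * (1 + t) ^ (r - 1)) =
      s * (1 + t) ^ κ + (1 - s) - (1 + s) * (1 + t) ^ r + s * (1 + t) ^ (r - 1) := by
    have h1 : (0 : ℝ) < 1 + t := by linarith [ht.1]
    have h2 : (1 + t) ^ (r - 1) = (1 + t) ^ r / (1 + t) := by
      rw [Real.rpow_sub h1, Real.rpow_one]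
    rw [h2]; field_simp; ring
  rw [e]
  refine abs_le_of_second_deriv (ε := 1)
    (φ := fun t => s * (1 + t) ^ κ + (1 - s) - (1 + s) * (1 + t) ^ r + s * (1 + t) ^ (r - 1))
    (φ1 := fun t => s * (κ * (1 + t) ^ (κ - 1)) - (1 + s) * (r * (1 + t) ^ (r - 1)) +
      s * ((r - 1) * (1 + t) ^ (r - 1 - 1))) (φ2 := ψ2) ?_ ?_ ?_ ?_ hM ht
  · simp
  · simp only [add_zero, Real.one_rpow]; rw [hr]; ring
  · intro t ht
    exact ((((hd κ t ht).const_mul s).add_const (1 - s)).sub ((hd r t ht).const_mul (1 + s))).add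
      ((hd (r - 1) t ht).const_mul s)
  · intro t ht
    exact ((((hd (κ - 1) t ht).const_mul κ).const_mul s).sub
      (((hd (r - 1) t ht).const_mul r).const_mul (1 + s))).add
      (((hd (r - 1 - 1) t ht).const_mul (r - 1)).const_mul s)

/-- The integral that governs the first order behaviour of the deficit below the exponent `2`. -/
lemma integral_meanGap_rpow {κ s : ℝ} (hκ : 0 < κ) (hκ2 : κ < 2) (hs : s ∈ Ioo (0 : ℝ) 1) :
    ∫ y in Ioi (0 : ℝ), meanGap s ((y + 1) ^ (κ - 1)) (y ^ (κ - 1)) =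
      s * (1 - s * (κ - 1)) / κ * ProbabilityTheory.beta (s + κ * (1 - s)) (2 - κ) - s / κ := by
  obtain ⟨hs0, hs1⟩ := id hs
  set a := s + κ * (1 - s) with ha
  have ha0 : 0 < a := by have := mul_pos hκ (sub_pos.2 hs1); linarith
  have hr : κ - a = s * (κ - 1) := by rw [ha]; ring
  set c := s * (1 - s * (κ - 1)) / κ with hc
  have hb : 0 < 2 - κ := by linarith
  -- The geometric mean is `y^(a-1) (1+y)^(κ-a)`. Differentiating `y^a (1+y)^(κ-a) / κ` reproduces
  -- it up to a term with `(1+y)^(κ-a-1)`; the last summand of `Φ` trades that term for a multiple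
  -- of the integrable beta kernel.
  set Φ : ℝ → ℝ := fun y => (s * (1 + y) ^ κ + (1 - s) * y ^ κ - y ^ a * (1 + y) ^ (κ - a) -
    s * (y ^ a * (1 + y) ^ (κ - a - 1))) / κ with hΦ
  have hint := (integrableOn_meanGap_rpow (p := κ - 1) (by linarith) (by linarith) hs)
  have hbint := integrableOn_Ioi_beta ha0 hb
  have key := integral_Ioi_of_hasDerivAt_of_tendsto (f := Φ) (a := 0) (m := 0)
    (f' := fun y => meanGap s ((y + 1) ^ (κ - 1)) (y ^ (κ - 1)) -
      c * (y ^ (a - 1) * (1 + y) ^ (-(a + (2 - κ))))) ?_ ?_ (hint.sub (hbint.const_mul c)) ?_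
  · rw [integral_sub hint (hbint.const_mul c), integral_const_mul, integral_Ioi_eq_beta ha0 hb] at key
    have : Φ 0 = s / κ := by
      simp [hΦ, Real.zero_rpow hκ.ne', Real.zero_rpow ha0.ne']
    rw [this] at key
    linarith
  · refine ContinuousAt.continuousWithinAt ?_
    have h1 : ∀ p : ℝ, ContinuousAt (fun y : ℝ => (1 + y) ^ p) 0 := fun p =>
      ContinuousAt.rpow_const (by fun_prop) (Or.inl (by norm_num))
    have h2 : ∀ p : ℝ, 0 < p → ContinuousAt (fun y : ℝ => y ^ p) 0 := fun p hp =>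
      ContinuousAt.rpow_const (by fun_prop) (Or.inr hp.le)
    have g1 := h1 κ
    have g2 := h1 (κ - a)
    have g3 := h1 (κ - a - 1)
    have g4 := h2 κ hκ
    have g5 := h2 a ha0
    fun_prop
  · intro y hy
    have hy : 0 < y := hy
    have hy1 : 0 < 1 + y := by linarith
    have d1 : ∀ p : ℝ, HasDerivAt (fun y : ℝ => (1 + y) ^ p) (p * (1 + y) ^ (p - 1)) y := by
      intro p
      have h := ((hasDerivAt_id y).const_add 1).rpow_const (p := p)
        (Or.inl (by simp only [id]; linarith))
      convert! h using 1
      simp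
    have d2 : ∀ p : ℝ, HasDerivAt (fun y : ℝ => y ^ p) (p * y ^ (p - 1)) y := fun p =>
      Real.hasDerivAt_rpow_const (Or.inl hy.ne')
    have h := (((((d1 κ).const_mul s).add ((d2 κ).const_mul (1 - s))).sub
      ((d2 a).mul (d1 (κ - a)))).sub (((d2 a).mul (d1 (κ - a - 1))).const_mul s)).div_const κ
    convert! h using 1
    have e1 : ((y + 1) ^ (κ - 1)) ^ s * (y ^ (κ - 1)) ^ (1 - s) =
        y ^ (a - 1) * (1 + y) ^ (κ - a) := by
      rw [← Real.rpow_mul (by linarith), ← Real.rpow_mul hy.le, add_comm y 1, mul_comm]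
      congr 2 <;> rw [ha] <;> ring
    have e2 : (1 + y) ^ (-(a + (2 - κ))) = (1 + y) ^ (κ - a) / (1 + y) ^ 2 := by
      rw [show -(a + (2 - κ)) = κ - a - (2 : ℕ) by push_cast; ring, Real.rpow_sub_natCast hy1.ne']
    have e3 : (1 + y) ^ (κ - a - 1) = (1 + y) ^ (κ - a) / (1 + y) := by
      rw [Real.rpow_sub hy1, Real.rpow_one]
    have e4 : (1 + y) ^ (κ - a - 1 - 1) = (1 + y) ^ (κ - a) / (1 + y) ^ 2 := by
      rw [show κ - a - 1 - 1 = κ - a - (2 : ℕ) by push_cast; ring, Real.rpow_sub_natCast hy1.ne']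
    have e5 : y ^ a = y ^ (a - 1) * y := by
      rw [Real.rpow_sub hy, Real.rpow_one]; field_simp
    unfold meanGap
    rw [e1, e2, e3, e4, e5, add_comm y 1]
    have hs' : a = κ - s * (κ - 1) := by rw [ha]; ring
    rw [hc]
    generalize y ^ (a - 1) = u
    generalize (1 + y) ^ (κ - a) = v
    generalize (1 + y) ^ (κ - 1) = w
    generalize y ^ (κ - 1) = z
    rw [hs']
    field_simp
    ring
  -- At infinity `Φ` is `O(y^(κ-2))`, because the terms of orders `y^κ` and `y^(κ-1)` cancel. This
  -- is where `κ < 2` gives the limit `0`.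
  · obtain ⟨M, hM⟩ := exists_abs_combination_le s κ (κ - a) hr
    have hlim : Tendsto (fun y : ℝ => M / κ * y ^ (-(2 - κ))) atTop (𝓝 0) := by
      simpa using (tendsto_rpow_neg_atTop hb).const_mul (M / κ)
    refine squeeze_zero_norm' ?_ hlim
    filter_upwards [eventually_ge_atTop 1] with y hy
    have hy0 : 0 < y := by linarith
    have h := hM y⁻¹ ⟨by positivity, inv_le_one_of_one_le₀ hy⟩
    have e0 : ∀ p : ℝ, (1 + y) ^ p = y ^ p * (1 + y⁻¹) ^ p := fun p => by
      rw [← Real.mul_rpow hy0.le (by positivity)]; congr 1; field_simp; ring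
    have e : Φ y = y ^ κ / κ * (s * (1 + y⁻¹) ^ κ + (1 - s) - (1 + y⁻¹) ^ (κ - a) -
        s * (y⁻¹ * (1 + y⁻¹) ^ (κ - a - 1))) := by
      have e6 : y ^ a * y ^ (κ - a) = y ^ κ := by rw [← Real.rpow_add hy0]; congr 1; ring
      have e7 : y ^ a * y ^ (κ - a - 1) = y ^ κ * y⁻¹ := by
        rw [← Real.rpow_add hy0, ← Real.rpow_neg_one, ← Real.rpow_add hy0]; congr 1; ring
      simp only [hΦ, e0]
      rw [div_mul_eq_mul_div]
      congr 1
      linear_combination (-(1 + y⁻¹) ^ (κ - a)) * e6 - s * (1 + y⁻¹) ^ (κ - a - 1) * e7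
    have e8 : y ^ (-(2 - κ)) = y ^ κ * y⁻¹ ^ 2 := by
      rw [show -(2 - κ) = κ - (2 : ℕ) by push_cast; ring, Real.rpow_sub_natCast hy0.ne']
      field_simp
    rw [e, norm_mul, Real.norm_eq_abs, Real.norm_eq_abs, abs_of_pos (by positivity), e8]
    calc _ ≤ y ^ κ / κ * (M * y⁻¹ ^ 2) := by gcongr
      _ = _ := by ring

section Admissible

variable {f : ℝ → ℝ} {A κ : ℝ}

/-! ### Exponents below `2` -/

/-- Two-sided power bounds near the endpoint. -/
lemma EndpointCondition.exists_bounds (h : EndpointCondition f A κ) :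
    ∃ R c C : ℝ, 0 < R ∧ 0 < c ∧ 0 < C ∧ ∀ x ∈ Ioo 0 R, c * x ^ (κ - 1) ≤ f x ∧
      f x ≤ C * x ^ (κ - 1) ∧ |deriv f x| ≤ C * x ^ (κ - 1 - 1) := by
  have hA := h.A_pos
  obtain ⟨R1, hR1, h1⟩ := exists_near_rpow h.equiv (half_pos hA)
  obtain ⟨R2, D, hR2, hD, h2⟩ : ∃ R2 D : ℝ, 0 < R2 ∧ 0 < D ∧ ∀ x ∈ Ioo 0 R2,
      |deriv f x| ≤ D * x ^ (κ - 1 - 1) := by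
    by_cases hκ : κ = 1
    · obtain ⟨l, hl⟩ := h.limit_deriv_of_one hκ
      have h3 := hl.abs.eventually (gt_mem_nhds (by linarith : |l| < |l| + 1))
      obtain ⟨R2, hR2, h4⟩ := mem_nhdsGT_iff_exists_Ioo_subset.1 h3
      refine ⟨min R2 1, |l| + 1, lt_min hR2 one_pos, by positivity, fun x hx => ?_⟩
      have h5 : |deriv f x| < |l| + 1 := h4 ⟨hx.1, hx.2.trans_le (min_le_left _ _)⟩
      have h6 : 1 ≤ x ^ (κ - 1 - 1) := Real.one_le_rpow_of_pos_of_le_one_of_nonpos hx.1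
        (hx.2.le.trans (min_le_right _ _)) (by rw [hκ]; norm_num)
      nlinarith [abs_nonneg l]
    · have h3 := h.equiv_deriv hκ
      rw [show κ - 2 = κ - 1 - 1 by ring] at h3
      obtain ⟨R2, hR2, h4⟩ := exists_near_rpow h3 one_pos
      refine ⟨R2, |A * (κ - 1)| + 1, hR2, by positivity, fun x hx => ?_⟩
      have h5 := h4 x hx
      have h6 := Real.rpow_pos_of_pos hx.1 (κ - 1 - 1)
      have h7 := abs_add_le (deriv f x - A * (κ - 1) * x ^ (κ - 1 - 1))
        (A * (κ - 1) * x ^ (κ - 1 - 1))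
      rw [sub_add_cancel, abs_mul (A * (κ - 1)), abs_of_pos h6] at h7
      linarith
  refine ⟨min R1 R2, A / 2, max (3 * A / 2) D, lt_min hR1 hR2, by positivity, by positivity,
    fun x hx => ?_⟩
  have h3 := abs_le.1 (h1 x ⟨hx.1, hx.2.trans_le (min_le_left _ _)⟩)
  have h4 := h2 x ⟨hx.1, hx.2.trans_le (min_le_right _ _)⟩
  have h5 := Real.rpow_pos_of_pos hx.1 (κ - 1)
  refine ⟨by linarith, ?_, h4.trans ?_⟩
  · calc f x ≤ 3 * A / 2 * x ^ (κ - 1) := by linarith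
      _ ≤ _ := by gcongr; exact le_max_left _ _
  · have := Real.rpow_pos_of_pos hx.1 (κ - 1 - 1)
    gcongr; exact le_max_right _ _

lemma Admissible.exists_near_bound (h : Admissible f A κ) :
    ∃ R K : ℝ, 0 < R ∧ 0 < K ∧ ∀ x ε s : ℝ, 0 < x → 0 < ε → x + ε < R → s ∈ Ioo (0 : ℝ) 1 →
      meanGap s (f (x + ε)) (f x) ≤ K * (ε ^ (κ - 1) * scaleBound (κ - 1) (x / ε)) := by
  obtain ⟨R, c, C, hR, hc, hC, hb⟩ := h.endpoint.exists_bounds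
  obtain ⟨K, hK, hK'⟩ := exists_meanGap_le_scaleBound (κ - 1) hc hC
  refine ⟨R, K, hR, hK, fun x ε s hx hε hxR hs => hK' f (deriv f) x ε s hx hε hs fun z hz => ?_⟩
  have hz0 := hx.trans_le hz.1
  obtain ⟨b1, b2, b3⟩ := hb z ⟨hz0, hz.2.trans_lt hxR⟩
  exact ⟨b1, b2, HalfLine.hasDerivAt h.density.contDiffOn hz0, b3⟩

/-- The `O(ε²)` form of the tail estimate, sufficient for `κ ≤ 2`, where the leading order is larger
than `ε²`. -/
lemma Admissible.tail_isBigO (h : Admissible f A κ) {η : ℝ} (hη : 0 < η) :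
    ∃ C δ : ℝ, 0 < δ ∧ 0 ≤ C ∧ ∀ ε ∈ Ioc 0 δ, ∀ s ∈ Ioo (0 : ℝ) 1,
      |∫ x in Ioi η, meanGap s (f (x + ε)) (f x)| ≤ C * ε ^ 2 := by
  obtain ⟨-, C, δ, hδ, hC, hb⟩ := exists_tail_bound h.density h.tail hη
  set J := ∫ x in Ioi η, (f x)⁻¹ * deriv f x ^ 2
  refine ⟨C * δ + |J|, δ, hδ, by positivity, fun ε hε s hs => ?_⟩
  have h1 := hb ε hε s hs
  have h2 := abs_add_le ((∫ x in Ioi η, meanGap s (f (x + ε)) (f x)) - s * (1 - s) / 2 * ε ^ 2 * J)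
    (s * (1 - s) / 2 * ε ^ 2 * J)
  rw [sub_add_cancel] at h2
  have h3 : |s * (1 - s) / 2 * ε ^ 2 * J| ≤ ε ^ 2 * |J| := by
    have : 0 ≤ s * (1 - s) := mul_nonneg hs.1.le (sub_nonneg.2 hs.2.le)
    rw [abs_mul, abs_of_nonneg (by positivity)]
    gcongr
    have : s * (1 - s) / 2 ≤ 1 := by nlinarith [hs.1, hs.2]
    nlinarith [sq_nonneg ε]
  have h4 : C * ε ^ 3 ≤ C * δ * ε ^ 2 := by
    have : ε ^ 3 = ε * ε ^ 2 := by ring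
    rw [this, mul_assoc]
    gcongr
    exact hε.2
  linarith

lemma deficit_eq (hd : IsHalfLineDensity f) {ε s η : ℝ} (hη : 0 < η) (hs : s ∈ Ioo (0 : ℝ) 1) :
    deficit f ε s = s * (∫ x in Ioc 0 ε, f x) + (∫ x in Ioc 0 η, meanGap s (f (x + ε)) (f x)) +
      ∫ x in Ioi η, meanGap s (f (x + ε)) (f x) := by
  have hi := integrable_meanGap_shift hd hs ε
  rw [deficit, ← Ioc_union_Ioi_eq_Ioi hη.le, setIntegral_union Ioc_disjoint_Ioi_same
    measurableSet_Ioi hi.integrableOn hi.integrableOn, add_assoc]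

lemma eventually_shiftFilter {P : ℝ → ℝ → Prop}
    (h : ∀ᶠ ε in 𝓝[>] (0 : ℝ), ∀ s ∈ Ioo (0 : ℝ) 1, P ε s) : ∀ᶠ q in shiftFilter, P q.1 q.2 :=
  eventually_prod_principal_iff.2 h

lemma tendsto_shiftFilter_of_abs_le {u : ℝ → ℝ → ℝ} {b : ℝ → ℝ}
    (h : ∀ᶠ ε in 𝓝[>] (0 : ℝ), ∀ s ∈ Ioo (0 : ℝ) 1, |u ε s| ≤ b ε)
    (hb : Tendsto b (𝓝[>] 0) (𝓝 0)) :
    Tendsto (fun q : ℝ × ℝ => u q.1 q.2) shiftFilter (𝓝 0) :=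
  squeeze_zero_norm' (a := fun q : ℝ × ℝ => b q.1) (eventually_shiftFilter h)
    (hb.comp tendsto_fst)

lemma tendsto_mul_rpow_neg (hf : f ~[𝓝[>] 0] fun x => A * x ^ (κ - 1)) {z : ℝ} (hz : 0 < z) :
    Tendsto (fun ε : ℝ => ε ^ (1 - κ) * f (ε * z)) (𝓝[>] 0) (𝓝 (A * z ^ (κ - 1))) := by
  have h1 : Tendsto (fun x : ℝ => f x / x ^ (κ - 1)) (𝓝[>] 0) (𝓝 A) := by
    rw [Metric.tendsto_nhds]
    intro τ hτ
    obtain ⟨η, hη, h⟩ := exists_near_rpow hf (half_pos hτ)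
    filter_upwards [Ioo_mem_nhdsGT hη] with x hx
    have hxp := Real.rpow_pos_of_pos hx.1 (κ - 1)
    rw [Real.dist_eq, show f x / x ^ (κ - 1) - A = (f x - A * x ^ (κ - 1)) / x ^ (κ - 1) by
      field_simp, abs_div, abs_of_pos hxp, div_lt_iff₀ hxp]
    exact (h x hx).trans_lt (by gcongr; linarith)
  have h2 : Tendsto (fun ε : ℝ => ε * z) (𝓝[>] 0) (𝓝[>] 0) := by
    refine tendsto_nhdsWithin_iff.2 ⟨?_, ?_⟩
    · have : Tendsto (fun ε : ℝ => ε * z) (𝓝 0) (𝓝 (0 * z)) := tendsto_id.mul_const z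
      rw [zero_mul] at this
      exact this.mono_left nhdsWithin_le_nhds
    · filter_upwards [self_mem_nhdsWithin] with ε hε
      exact mul_pos hε hz
  refine ((h1.comp h2).mul_const (z ^ (κ - 1))).congr' ?_
  filter_upwards [self_mem_nhdsWithin] with ε hε
  have hε : 0 < ε := hε
  have e : ε ^ (1 - κ) = (ε ^ (κ - 1))⁻¹ := by
    rw [← Real.rpow_neg hε.le]; congr 1; ring
  have : 0 < ε ^ (κ - 1) := by positivity
  have : 0 < z ^ (κ - 1) := by positivity
  simp only [Function.comp]
  rw [Real.mul_rpow hε.le hz.le, e]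
  field_simp

/-- The contribution of a neighbourhood of the endpoint, for exponents below `2`. -/
lemma Admissible.tendsto_near (h : Admissible f A κ) (hκ2 : κ < 2) :
    ∃ η, 0 < η ∧ Tendsto (fun q : ℝ × ℝ =>
      (∫ x in Ioc 0 η, meanGap q.2 (f (x + q.1)) (f x)) / q.1 ^ κ -
        A * ∫ y in Ioi (0 : ℝ), meanGap q.2 ((y + 1) ^ (κ - 1)) (y ^ (κ - 1)))
      shiftFilter (𝓝 0) := by
  have hκ := h.endpoint.kappa_pos
  have hA := h.endpoint.A_pos
  have hd := h.density
  obtain ⟨R, K, hR, hK, hb⟩ := h.exists_near_bound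
  obtain ⟨K', hK', hb'⟩ := exists_meanGap_rpow_le (κ - 1)
  set η := R / 2 with hη
  have hη0 : 0 < η := by positivity
  refine ⟨η, hη0, ?_⟩
  -- The rescaled gap minus its limit. The limit depends on `s`, so dominated convergence is applied
  -- to this difference, along the product filter, with limit `0`.
  set G : ℝ × ℝ → ℝ → ℝ := fun q y =>
    q.1 ^ (1 - κ) * (Iic η).indicator (fun x => meanGap q.2 (f (x + q.1)) (f x)) (q.1 * y) -
      A * meanGap q.2 ((y + 1) ^ (κ - 1)) (y ^ (κ - 1)) with hG
  have hsmall : ∀ᶠ q in shiftFilter, q.1 ∈ Ioo 0 η ∧ q.2 ∈ Ioo (0 : ℝ) 1 := by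
    refine eventually_shiftFilter (P := fun ε s => ε ∈ Ioo 0 η ∧ s ∈ Ioo (0 : ℝ) 1) ?_
    filter_upwards [Ioo_mem_nhdsGT hη0] with ε hε s hs
    exact ⟨hε, hs⟩
  have hi1 : ∀ q : ℝ × ℝ, q.1 ∈ Ioo 0 η ∧ q.2 ∈ Ioo (0 : ℝ) 1 → IntegrableOn (fun y =>
      (Iic η).indicator (fun x => meanGap q.2 (f (x + q.1)) (f x)) (q.1 * y)) (Ioi 0) := by
    intro q hq
    exact (((integrable_meanGap_shift hd hq.2 q.1).indicator
      measurableSet_Iic).comp_mul_left' hq.1.1.ne').integrableOn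
  have hi2 : ∀ q : ℝ × ℝ, q.1 ∈ Ioo 0 η ∧ q.2 ∈ Ioo (0 : ℝ) 1 → IntegrableOn (fun y =>
      meanGap q.2 ((y + 1) ^ (κ - 1)) (y ^ (κ - 1))) (Ioi 0) := fun q hq =>
    integrableOn_meanGap_rpow (by linarith) (by linarith) hq.2
  have hmain : Tendsto (fun q => ∫ y in Ioi 0, G q y) shiftFilter (𝓝 (∫ y in Ioi (0 : ℝ), 0)) := by
    refine tendsto_integral_filter_of_dominated_convergence
      (fun y => (K + A * K') * scaleBound (κ - 1) y) ?_ ?_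
      ((integrableOn_scaleBound (by linarith) (by linarith)).const_mul _) ?_
    · filter_upwards [hsmall] with q hq
      exact (((hi1 q hq).const_mul _).sub ((hi2 q hq).const_mul A)).aestronglyMeasurable
    · filter_upwards [hsmall] with q hq
      refine (ae_restrict_iff' measurableSet_Ioi).2 (Eventually.of_forall fun y hy => ?_)
      have hy : 0 < y := hy
      obtain ⟨⟨hq1, hq2⟩, hs⟩ := hq
      have hsb := scaleBound_nonneg (p := κ - 1) hy.le
      have b1 : |q.1 ^ (1 - κ) *
          (Iic η).indicator (fun x => meanGap q.2 (f (x + q.1)) (f x)) (q.1 * y)| ≤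
          K * scaleBound (κ - 1) y := by
        by_cases hm : q.1 * y ∈ Iic η
        · rw [indicator_of_mem hm, abs_of_nonneg (mul_nonneg (by positivity)
            (meanGap_nonneg hs (hd.nonneg _) (hd.nonneg _)))]
          have hm : q.1 * y ≤ η := hm
          have b2 := hb (q.1 * y) q.1 q.2 (by positivity) hq1 (by linarith) hs
          rw [mul_div_cancel_left₀ y hq1.ne'] at b2
          have e : q.1 ^ (1 - κ) * q.1 ^ (κ - 1) = 1 := by
            rw [← Real.rpow_add hq1]; simp
          calc _ ≤ q.1 ^ (1 - κ) * (K * (q.1 ^ (κ - 1) * scaleBound (κ - 1) y)) := by gcongr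
            _ = K * scaleBound (κ - 1) y := by
              linear_combination (K * scaleBound (κ - 1) y) * e
        · rw [indicator_of_notMem hm, mul_zero, abs_zero]; positivity
      have b3 : |A * meanGap q.2 ((y + 1) ^ (κ - 1)) (y ^ (κ - 1))| ≤
          A * K' * scaleBound (κ - 1) y := by
        rw [abs_of_nonneg (mul_nonneg hA.le (meanGap_nonneg hs (by positivity) (by positivity))),
          mul_assoc]
        gcongr
        exact hb' y q.2 hy hs
      refine (abs_sub _ _).trans ((add_le_add b1 b3).trans_eq ?_)
      ring
    · refine (ae_restrict_iff' measurableSet_Ioi).2 (Eventually.of_forall fun y hy => ?_)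
      have hy : 0 < y := hy
      have l1 := (tendsto_mul_rpow_neg h.endpoint.equiv (by linarith : 0 < y + 1)).comp
        (tendsto_fst (f := 𝓝[>] (0 : ℝ)) (g := 𝓟 (Ioo (0 : ℝ) 1)))
      have l2 := (tendsto_mul_rpow_neg h.endpoint.equiv hy).comp
        (tendsto_fst (f := 𝓝[>] (0 : ℝ)) (g := 𝓟 (Ioo (0 : ℝ) 1)))
      have l3 := tendsto_meanGap_sub (s := Prod.snd) (hsmall.mono fun q hq => hq.2)
        (by positivity) (by positivity) l1 l2
      refine l3.congr' ?_
      have hsm : ∀ᶠ q in shiftFilter, q.1 < η / y := by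
        refine eventually_shiftFilter (P := fun ε _ => ε < η / y) ?_
        filter_upwards [Ioo_mem_nhdsGT (by positivity : 0 < η / y)] with ε hε s hs
        exact hε.2
      filter_upwards [hsmall, hsm] with q hq hqy
      have hq1 := hq.1.1
      have hm : q.1 * y ∈ Iic η := ((lt_div_iff₀ hy).1 hqy).le
      simp only [hG, Function.comp]
      -- Homogeneity moves `ε^(1-κ)` and `A` inside the gap, which matches the convergence of
      -- `ε^(1-κ) f (ε z)` to `A z^(κ-1)`.
      rw [indicator_of_mem hm, ← meanGap_mul (by positivity) (hd.nonneg _) (hd.nonneg _),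
        ← meanGap_mul hA.le (by positivity) (by positivity), mul_add, mul_one]
  rw [integral_zero] at hmain
  refine hmain.congr' ?_
  filter_upwards [hsmall] with q hq
  have hq1 := hq.1.1
  simp only [hG]
  rw [integral_sub ((hi1 q hq).const_mul _) ((hi2 q hq).const_mul A), integral_const_mul,
    integral_const_mul, integral_comp_mul_left_Ioi _ _ hq1, mul_zero,
    setIntegral_indicator measurableSet_Iic, Ioi_inter_Iic, smul_eq_mul]
  congr 1
  rw [Real.rpow_sub hq1, Real.rpow_one]
  field_simp

/-- First order asymptotics of the deficit for exponents below `2`. -/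
lemma Admissible.tendsto_deficit_of_lt_two (h : Admissible f A κ) (hκ2 : κ < 2) :
    Tendsto (fun q : ℝ × ℝ => deficit f q.1 q.2 / q.1 ^ κ -
      A * q.2 * (1 - q.2 * (κ - 1)) * ProbabilityTheory.beta (q.2 + κ * (1 - q.2)) (2 - κ) / κ)
      shiftFilter (𝓝 0) := by
  have hκ := h.endpoint.kappa_pos
  obtain ⟨η, hη, hnear⟩ := h.tendsto_near hκ2
  obtain ⟨C, δ, hδ, hC, htail⟩ := h.tail_isBigO hη
  have t1 : Tendsto (fun q : ℝ × ℝ => q.2 * ((∫ x in Ioc 0 q.1, f x) / q.1 ^ κ - A / κ))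
      shiftFilter (𝓝 0) := by
    have hm := tendsto_integral_Ioc_div h.density.integrable hκ h.endpoint.equiv
    refine tendsto_shiftFilter_of_abs_le
      (u := fun ε s => s * ((∫ x in Ioc 0 ε, f x) / ε ^ κ - A / κ))
      (b := fun ε => |(∫ x in Ioc 0 ε, f x) / ε ^ κ - A / κ|) ?_ ?_
    · refine Eventually.of_forall fun ε s hs => ?_
      rw [abs_mul, abs_of_pos hs.1]
      exact mul_le_of_le_one_left (abs_nonneg _) hs.2.le
    · have := (hm.sub_const (A / κ)).abs
      simpa using this
  have t2 : Tendsto (fun q : ℝ × ℝ =>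
      (∫ x in Ioi η, meanGap q.2 (f (x + q.1)) (f x)) / q.1 ^ κ) shiftFilter (𝓝 0) := by
    refine tendsto_shiftFilter_of_abs_le
      (u := fun ε s => (∫ x in Ioi η, meanGap s (f (x + ε)) (f x)) / ε ^ κ)
      (b := fun ε => C * ε ^ (2 - κ)) ?_ ?_
    · filter_upwards [Ioc_mem_nhdsGT hδ] with ε hε s hs
      have hε0 := hε.1
      rw [abs_div, abs_of_pos (Real.rpow_pos_of_pos hε0 κ), Real.rpow_sub hε0, ← mul_div_assoc]
      gcongr
      simpa using htail ε hε s hs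
    · simpa using (tendsto_rpow_nhdsGT_zero (by linarith : 0 < 2 - κ)).const_mul C
  have t := (t1.add hnear).add t2
  simp only [add_zero] at t
  refine t.congr' ?_
  have hs : ∀ᶠ q in shiftFilter, q.2 ∈ Ioo (0 : ℝ) 1 :=
    eventually_shiftFilter (P := fun _ s => s ∈ Ioo (0 : ℝ) 1)
      (Eventually.of_forall fun _ _ hs => hs)
  filter_upwards [hs] with q hq
  -- The term `-s/κ` of the integral, multiplied by `A`, cancels the limit `A s/κ` coming from the
  -- mass of `(0, ε]`.
  rw [deficit_eq h.density hη hq, integral_meanGap_rpow hκ hκ2 hq]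
  ring

/-- The boundedness in `s` required for passing to the logarithm. It is read off from the gap
integral, whose majorant `scaleBound` is free of `s`. -/
lemma exists_abs_beta_le (hκ : 0 < κ) (hκ2 : κ < 2) : ∃ M, ∀ s ∈ Ioo (0 : ℝ) 1,
    |A * s * (1 - s * (κ - 1)) * ProbabilityTheory.beta (s + κ * (1 - s)) (2 - κ) / κ| ≤ M := by
  obtain ⟨K, hK, hb⟩ := exists_meanGap_rpow_le (κ - 1)
  refine ⟨|A| * (1 / κ + K * ∫ y in Ioi 0, scaleBound (κ - 1) y), fun s hs => ?_⟩
  have e : A * s * (1 - s * (κ - 1)) * ProbabilityTheory.beta (s + κ * (1 - s)) (2 - κ) / κ =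
      A * (s / κ + ∫ y in Ioi (0 : ℝ), meanGap s ((y + 1) ^ (κ - 1)) (y ^ (κ - 1))) := by
    rw [integral_meanGap_rpow hκ hκ2 hs]; ring
  have h0 : 0 ≤ ∫ y in Ioi (0 : ℝ), meanGap s ((y + 1) ^ (κ - 1)) (y ^ (κ - 1)) :=
    setIntegral_nonneg measurableSet_Ioi fun y (hy : 0 < y) =>
      meanGap_nonneg hs (by positivity) (by positivity)
  have hs0 := hs.1
  rw [e, abs_mul, abs_of_nonneg (add_nonneg (by positivity) h0)]
  gcongr
  · exact hs.2.le
  · rw [← integral_const_mul]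
    refine setIntegral_mono_on (integrableOn_meanGap_rpow (by linarith) (by linarith) hs)
      ((integrableOn_scaleBound (by linarith) (by linarith)).const_mul K) measurableSet_Ioi
      fun y hy => hb y s hy hs

lemma shift_integral_nonneg (hd : IsHalfLineDensity f) {ε s : ℝ} (hs : s ∈ Ioo (0 : ℝ) 1)
    (S : Set ℝ) : 0 ≤ ∫ x in S, meanGap s (f (x + ε)) (f x) :=
  integral_nonneg fun _ => meanGap_nonneg hs (hd.nonneg _) (hd.nonneg _)

/-! ### Exponents above `2` -/

/-- An integrable majorant of the rescaled gap near the endpoint for exponents above `2`. -/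
lemma rpow_mul_scaleBound_le {p ε x : ℝ} (hp : 1 < p) (hε : 0 < ε) (hε1 : ε ≤ 1) (hx : 0 < x) :
    ε ^ p * scaleBound p (x / ε) ≤
      ε ^ 2 * ((1 + 2 ^ p) * x ^ min (p - 2) 0 + x ^ (p - 2)) := by
  have hy : 0 < x / ε := by positivity
  have hxp : 0 < x ^ (p - 2) := by positivity
  unfold scaleBound
  split_ifs with h
  · have h1 : (x / ε) ^ p + (x / ε + 1) ^ p ≤ 1 + 2 ^ p :=
      add_le_add (Real.rpow_le_one hy.le h (by linarith))
        (Real.rpow_le_rpow (by positivity) (by linarith) (by linarith))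
    have h2 : 1 ≤ (x / ε) ^ min (p - 2) 0 :=
      -- The exponent `min (p - 2) 0` is nonpositive, so the power is at least `1` here. It is also
      -- greater than `-1` when `p > 1`, so it stays integrable at `0`.
      Real.one_le_rpow_of_pos_of_le_one_of_nonpos hy h (min_le_right _ _)
    have h3 : ε ^ p ≤ ε ^ 2 * ε ^ min (p - 2) 0 := by
      rw [← Real.rpow_natCast, ← Real.rpow_add hε]
      refine Real.rpow_le_rpow_of_exponent_ge hε hε1 ?_
      have := min_le_left (p - 2) 0
      push_cast; linarith
    calc ε ^ p * ((x / ε) ^ p + (x / ε + 1) ^ p)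
        ≤ (ε ^ 2 * ε ^ min (p - 2) 0) * ((1 + 2 ^ p) * (x / ε) ^ min (p - 2) 0) := by
          gcongr
          exact h1.trans (le_mul_of_one_le_right (by positivity) h2)
      _ = ε ^ 2 * ((1 + 2 ^ p) * x ^ min (p - 2) 0) := by
          rw [Real.div_rpow hx.le hε.le]
          have := Real.rpow_pos_of_pos hε (min (p - 2) 0)
          field_simp
      _ ≤ _ := by gcongr; linarith
  · have : ε ^ p * (x / ε) ^ (p - 2) = ε ^ 2 * x ^ (p - 2) := by
      rw [Real.div_rpow hx.le hε.le, Real.rpow_sub hε, Real.rpow_ofNat]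
      have := Real.rpow_pos_of_pos hε p
      field_simp
    rw [this]
    gcongr
    have := Real.rpow_pos_of_pos hx (min (p - 2) 0)
    have : 0 < (1 + (2 : ℝ) ^ p) * x ^ min (p - 2) 0 := by positivity
    linarith

/-- One integrable `g` serves two purposes: it dominates the Fisher integrand, and `ε² g` dominates
the gap. A small interval at the endpoint is therefore negligible on both sides of the limit. -/
lemma Admissible.exists_near_sq_bound (h : Admissible f A κ) (hκ : 2 < κ) :
    ∃ (R : ℝ) (g : ℝ → ℝ), 0 < R ∧ IntegrableOn g (Ioc 0 R) ∧ (∀ x ∈ Ioc 0 R,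
      (f x)⁻¹ * deriv f x ^ 2 ≤ g x) ∧ ∀ x ∈ Ioc 0 R, ∀ ε ∈ Ioc 0 R, ∀ s ∈ Ioo (0 : ℝ) 1,
      meanGap s (f (x + ε)) (f x) ≤ ε ^ 2 * g x := by
  obtain ⟨R, K, hR, hK, hb⟩ := h.exists_near_bound
  obtain ⟨R', c, C, hR', hc, hC, hb'⟩ := h.endpoint.exists_bounds
  set p := κ - 1 with hp
  set R₀ := min 1 (min (R / 3) (R' / 3)) with hR₀
  have r1 : R₀ ≤ 1 := min_le_left _ _
  have r2 : R₀ ≤ R / 3 := (min_le_right _ _).trans (min_le_left _ _)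
  have r3 : R₀ ≤ R' / 3 := (min_le_right _ _).trans (min_le_right _ _)
  refine ⟨R₀, fun x => K * ((1 + 2 ^ p) * x ^ min (p - 2) 0 + x ^ (p - 2)) +
    C ^ 2 / c * x ^ (p - 2), by positivity, ?_, ?_, ?_⟩
  · have i1 := integrableOn_Ioc_rpow (p := min (p - 2) 0) (lt_min (by linarith) (by norm_num)) R₀
    have i2 := integrableOn_Ioc_rpow (p := p - 2) (by linarith) R₀
    exact (((i1.const_mul (1 + 2 ^ p)).add i2).const_mul K).add (i2.const_mul (C ^ 2 / c))
  · intro x hx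
    have hx0 := hx.1
    obtain ⟨b1, b2, b3⟩ := hb' x ⟨hx.1, by linarith [hx.2]⟩
    have hfx := h.density.pos x hx0
    have e : (c * x ^ p)⁻¹ * (C * x ^ (p - 1)) ^ 2 = C ^ 2 / c * x ^ (p - 2) := by
      rw [Real.rpow_sub hx0 p 1, Real.rpow_sub hx0 p 2, Real.rpow_one, Real.rpow_ofNat]
      have := Real.rpow_pos_of_pos hx0 p
      field_simp
    have : (f x)⁻¹ * deriv f x ^ 2 ≤ C ^ 2 / c * x ^ (p - 2) := by
      rw [← e, ← sq_abs]
      gcongr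
    have h0 : 0 ≤ K * ((1 + 2 ^ p) * x ^ min (p - 2) 0 + x ^ (p - 2)) := by positivity
    simp only
    linarith
  · intro x hx ε hε s hs
    have hx0 := hx.1
    have b := hb x ε s hx.1 hε.1 (by linarith [hx.2, hε.2]) hs
    have b2 := mul_le_mul_of_nonneg_left
      (rpow_mul_scaleBound_le (p := p) (by linarith) hε.1 (hε.2.trans r1) hx.1) hK.le
    refine (b.trans b2).trans ?_
    have : 0 ≤ ε ^ 2 * (C ^ 2 / c * x ^ (p - 2)) := by positivity
    simp only
    linarith

lemma tendsto_integral_Ioc_zero {g : ℝ → ℝ} {R : ℝ} (hR : 0 < R) (hg : IntegrableOn g (Ioc 0 R)) :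
    Tendsto (fun η => ∫ x in Ioc 0 η, g x) (𝓝[>] 0) (𝓝 0) := by
  have hi : IntervalIntegrable g volume 0 R :=
    (intervalIntegrable_iff_integrableOn_Ioc_of_le hR.le).2 hg
  have hc := intervalIntegral.continuousOn_primitive_interval' hi left_mem_uIcc
  have h0 := (hc 0 left_mem_uIcc).tendsto
  simp only [intervalIntegral.integral_same] at h0
  rw [uIcc_of_le hR.le] at h0
  have h1 := h0.mono_left (nhdsWithin_mono (0 : ℝ) Ioc_subset_Icc_self)
  rw [nhdsWithin_Ioc_eq_nhdsGT hR] at h1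
  refine h1.congr' ?_
  filter_upwards [self_mem_nhdsWithin] with η hη
  exact intervalIntegral.integral_of_le (le_of_lt hη)

lemma Admissible.integrableOn_fisher (h : Admissible f A κ) (hκ : 2 < κ) :
    IntegrableOn (fun x => (f x)⁻¹ * deriv f x ^ 2) (Ioi 0) := by
  obtain ⟨R, g, hR, hg, hb, -⟩ := h.exists_near_sq_bound hκ
  have htail := (exists_tail_bound h.density h.tail hR).1
  rw [← Ioc_union_Ioi_eq_Ioi hR.le]
  refine IntegrableOn.union ?_ htail
  have hf := h.density.contDiffOn
  have hc : ContinuousOn (fun x => (f x)⁻¹ * deriv f x ^ 2) (Ioi 0) :=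
    (hf.continuousOn.inv₀ fun x hx => (h.density.pos x hx).ne').mul
      ((HalfLine.contDiffOn_deriv hf).continuousOn.pow 2)
  refine Integrable.mono' hg ((hc.mono Ioc_subset_Ioi_self).aestronglyMeasurable measurableSet_Ioc)
    ((ae_restrict_iff' measurableSet_Ioc).2 (Eventually.of_forall fun x hx => ?_))
  have := h.density.pos x hx.1
  rw [Real.norm_of_nonneg (by positivity)]
  exact hb x hx

/-- The cut `η` is fixed first, so that `∫ g` over `(0, η]` is small; then `ε → 0` with the tail
estimate on `(η, ∞)`. The mass of `(0, ε]` is of order `ε^κ`, hence `o(ε²)`. -/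
lemma Admissible.tendsto_deficit_of_two_lt (h : Admissible f A κ) (hκ : 2 < κ) :
    Tendsto (fun q : ℝ × ℝ => deficit f q.1 q.2 / q.1 ^ 2 -
      q.2 * (1 - q.2) / 2 * fisherInfo f) shiftFilter (𝓝 0) := by
  have hd := h.density
  have hJi := h.integrableOn_fisher hκ
  obtain ⟨R, g, hR, hg, hbJ, hb⟩ := h.exists_near_sq_bound hκ
  rw [Metric.tendsto_nhds]
  intro τ hτ
  have hgt := (tendsto_integral_Ioc_zero hR hg).eventually (gt_mem_nhds (by positivity : 0 < τ / 8))
  obtain ⟨η, hgη, hη⟩ := (hgt.and (Ioc_mem_nhdsGT hR)).exists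
  obtain ⟨-, C, δ, hδ, hC, htail⟩ := exists_tail_bound hd h.tail hη.1
  have hmass : Tendsto (fun ε : ℝ => (∫ x in Ioc 0 ε, f x) / ε ^ 2) (𝓝[>] 0) (𝓝 0) := by
    have h1 := tendsto_integral_Ioc_div hd.integrable h.endpoint.kappa_pos h.endpoint.equiv
    have h3 := h1.mul (tendsto_rpow_nhdsGT_zero (by linarith : 0 < κ - 2))
    rw [mul_zero] at h3
    refine h3.congr' ?_
    filter_upwards [self_mem_nhdsWithin] with ε hε
    have hε : 0 < ε := hε
    rw [Real.rpow_sub hε, Real.rpow_ofNat]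
    field_simp
  have hCε : Tendsto (fun ε : ℝ => C * ε) (𝓝[>] 0) (𝓝 0) := by
    have : Tendsto (fun ε : ℝ => C * ε) (𝓝 0) (𝓝 (C * 0)) := tendsto_id.const_mul C
    rw [mul_zero] at this
    exact this.mono_left nhdsWithin_le_nhds
  refine eventually_shiftFilter
    (P := fun ε s => dist (deficit f ε s / ε ^ 2 - s * (1 - s) / 2 * fisherInfo f) 0 < τ) ?_
  filter_upwards [hmass.eventually (gt_mem_nhds (by positivity : 0 < τ / 8)),
    hCε.eventually (gt_mem_nhds (by positivity : 0 < τ / 8)), Ioc_mem_nhdsGT hδ, Ioc_mem_nhdsGT hR]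
    with ε a1 a2 a3 a4 s hs
  have hε := a3.1
  have hε2 : 0 < ε ^ 2 := by positivity
  rw [dist_zero_right, Real.norm_eq_abs, deficit_eq hd hη.1 hs]
  set F := ∫ x in Ioc 0 ε, f x
  set N := ∫ x in Ioc 0 η, meanGap s (f (x + ε)) (f x)
  set T := ∫ x in Ioi η, meanGap s (f (x + ε)) (f x)
  have hsub : Ioc 0 η ⊆ Ioc 0 R := Ioc_subset_Ioc_right hη.2
  have hJ : fisherInfo f = (∫ x in Ioc 0 η, (f x)⁻¹ * deriv f x ^ 2) +
      ∫ x in Ioi η, (f x)⁻¹ * deriv f x ^ 2 := by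
    rw [fisherInfo, ← Ioc_union_Ioi_eq_Ioi hη.1.le]
    exact setIntegral_union Ioc_disjoint_Ioi_same measurableSet_Ioi
      (hJi.mono_set Ioc_subset_Ioi_self) (hJi.mono_set (Ioi_subset_Ioi hη.1.le))
  rw [hJ]
  have hT := htail ε a3 s hs
  set J1 := ∫ x in Ioc 0 η, (f x)⁻¹ * deriv f x ^ 2
  set J2 := ∫ x in Ioi η, (f x)⁻¹ * deriv f x ^ 2
  have hF0 : 0 ≤ F := integral_nonneg fun _ => hd.nonneg _
  have hN0 : 0 ≤ N := shift_integral_nonneg hd hs _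
  have hJ10 : 0 ≤ J1 := setIntegral_nonneg measurableSet_Ioc fun x hx => by
    have := hd.pos x hx.1
    positivity
  have hJ1 : J1 ≤ ∫ x in Ioc 0 η, g x :=
    setIntegral_mono_on (hJi.mono_set Ioc_subset_Ioi_self) (hg.mono_set hsub) measurableSet_Ioc
      fun x hx => hbJ x (hsub hx)
  have hN : N ≤ ε ^ 2 * ∫ x in Ioc 0 η, g x := by
    rw [← integral_const_mul]
    exact setIntegral_mono_on (integrable_meanGap_shift hd hs ε).integrableOn
      ((hg.mono_set hsub).const_mul _) measurableSet_Ioc fun x hx => hb x (hsub hx) ε a4 s hs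
  have e : (s * F + N + T) / ε ^ 2 - s * (1 - s) / 2 * (J1 + J2) =
      s * (F / ε ^ 2) + N / ε ^ 2 + (T - s * (1 - s) / 2 * ε ^ 2 * J2) / ε ^ 2 -
        s * (1 - s) / 2 * J1 := by
    field_simp; ring
  have c1 : |s * (F / ε ^ 2)| ≤ τ / 8 := by
    rw [abs_of_nonneg (mul_nonneg hs.1.le (by positivity))]
    exact (mul_le_of_le_one_left (by positivity) hs.2.le).trans a1.le
  have c2 : |N / ε ^ 2| ≤ τ / 8 := by
    rw [abs_of_nonneg (by positivity), div_le_iff₀ hε2]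
    nlinarith
  have c3 : |(T - s * (1 - s) / 2 * ε ^ 2 * J2) / ε ^ 2| ≤ τ / 8 := by
    rw [abs_div, abs_of_pos hε2, div_le_iff₀ hε2]
    nlinarith
  have c4 : |s * (1 - s) / 2 * J1| ≤ τ / 8 := by
    have : 0 ≤ s * (1 - s) := mul_nonneg hs.1.le (sub_nonneg.2 hs.2.le)
    rw [abs_of_nonneg (by positivity)]
    refine le_trans (mul_le_of_le_one_left hJ10 ?_) (hJ1.trans hgη.le)
    nlinarith [hs.1, hs.2]
  rw [e]
  have d1 := abs_sub (s * (F / ε ^ 2) + N / ε ^ 2 +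
    (T - s * (1 - s) / 2 * ε ^ 2 * J2) / ε ^ 2) (s * (1 - s) / 2 * J1)
  have d2 := abs_add_le (s * (F / ε ^ 2) + N / ε ^ 2) ((T - s * (1 - s) / 2 * ε ^ 2 * J2) / ε ^ 2)
  have d3 := abs_add_le (s * (F / ε ^ 2)) (N / ε ^ 2)
  linarith

/-! ### The exponent `2` -/

/-- Here `f` is close to `A x` and `f'` to `A`. For `ε` small relative to `x` the ratio `f (x + ε) /
f x` is `1 + ρ` with `ρ` about `ε/x`, and the gap is about `f x · s(1-s)/2 · ρ²`. -/
lemma Admissible.exists_abs_meanGap_sub_le (h : Admissible f A 2) {τ : ℝ} (hτ : 0 < τ) :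
    ∃ η k : ℝ, 0 < η ∧ 0 < k ∧ k ≤ 1 ∧ ∀ x ∈ Ioc 0 η, ∀ ε : ℝ, 0 < ε → ε ≤ k * x →
      ∀ s ∈ Ioo (0 : ℝ) 1,
      |meanGap s (f (x + ε)) (f x) - s * (1 - s) / 2 * A * (ε ^ 2 * x⁻¹)| ≤ τ * (ε ^ 2 * x⁻¹) := by
  have hA := h.endpoint.A_pos
  -- `μ` is the relative precision of `f ≈ A x` and `f' ≈ A`, and `k` bounds `ε/x`. The constants
  -- `14` and `27` are those that make each of the errors `b2` and `b1` at most `τ/2` times `ε²/x`.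
  set μ := min (1 / 2) (τ / (14 * A)) with hμ
  have hμ0 : 0 < μ := by positivity
  have hμ1 : μ ≤ 1 / 2 := min_le_left _ _
  have hμ2 : μ * (14 * A) ≤ τ := by
    rw [← le_div_iff₀ (by positivity)]; exact min_le_right _ _
  have hμA : 0 < μ * A := by positivity
  set k := min 1 (τ / (27 * A)) with hk
  have hk0 : 0 < k := by positivity
  have hk1 : k ≤ 1 := min_le_left _ _
  have hk2 : k * (27 * A) ≤ τ := by
    rw [← le_div_iff₀ (by positivity)]; exact min_le_right _ _
  obtain ⟨R1, hR1, h1⟩ := exists_near_rpow h.endpoint.equiv hμA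
  obtain ⟨R2, hR2, h2⟩ := exists_near_rpow (h.endpoint.equiv_deriv (by norm_num)) hμA
  have e1 : (2 : ℝ) - 1 = 1 := by norm_num
  simp only [e1, Real.rpow_one, sub_self, Real.rpow_zero, mul_one] at h1 h2
  set R := min R1 R2 with hR
  have hR0 : 0 < R := lt_min hR1 hR2
  refine ⟨R / 3, k, by positivity, hk0, hk1, fun x hx ε hε hεx s hs => ?_⟩
  have hx0 := hx.1
  have hεx' : ε ≤ x := hεx.trans (mul_le_of_le_one_left hx0.le hk1)
  have hxR : x + ε < R := by linarith [hx.2]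
  obtain ⟨ξ, hξ, hξe⟩ := exists_hasDerivAt_eq_slope f (deriv f) (by linarith : x < x + ε)
    (h.density.contDiffOn.continuousOn.mono fun z hz => hx0.trans_le hz.1)
    (fun z hz => HalfLine.hasDerivAt h.density.contDiffOn (hx0.trans hz.1))
  have hξ0 : 0 < ξ := hx0.trans hξ.1
  rw [add_sub_cancel_left, eq_div_iff hε.ne'] at hξe
  have hP := abs_le.1 (h2 ξ ⟨hξ0, by linarith [hξ.2, min_le_right R1 R2]⟩)
  have hQ := abs_le.1 (h1 x ⟨hx0, by linarith [min_le_left R1 R2]⟩)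
  set P := deriv f ξ
  have hfx := h.density.pos x hx0
  set Q := f x / x with hQdef
  have hfQ : f x = Q * x := by rw [hQdef]; field_simp
  have hQ1 : -(μ * A) ≤ Q - A ∧ Q - A ≤ μ * A := by
    rw [hfQ, ← neg_mul, ← sub_mul] at hQ
    exact ⟨le_of_mul_le_mul_right hQ.1 hx0, le_of_mul_le_mul_right hQ.2 hx0⟩
  have hμA2 : μ * A ≤ A / 2 := by
    linarith [mul_le_mul_of_nonneg_right hμ1 hA.le]
  have hQ0 : A / 2 ≤ Q := by linarith [hQ1.1]
  have hP0 : A / 2 ≤ P := by linarith [hP.1]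
  have hP1 : P ≤ 3 / 2 * A := by linarith [hP.2]
  have hQpos : 0 < Q := by linarith
  have hPpos : 0 < P := by linarith
  set ρ := P * ε / (Q * x) with hρ
  have hρ0 : 0 ≤ ρ := by positivity
  have hgap : meanGap s (f (x + ε)) (f x) = Q * x * meanGap s (1 + ρ) 1 := by
    rw [← meanGap_mul (by positivity) (by positivity) zero_le_one, mul_one, hfQ]
    congr 1
    rw [mul_add, mul_one, hρ, mul_div_cancel₀ _ (by positivity), hξe, hfQ]
    ring
  have hT := abs_meanGap_one_add_sub_le hs hρ0
  set σ := s * (1 - s) / 2 with hσ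
  have hσ0 : 0 ≤ σ := by
    have : 0 ≤ s * (1 - s) := mul_nonneg hs.1.le (sub_nonneg.2 hs.2.le)
    positivity
  have hσ1 : σ ≤ 1 := by rw [hσ]; nlinarith [hs.1, hs.2]
  -- The first summand is the cubic Taylor error in `ρ`; the second replaces the coefficient `P²/Q`
  -- by `A`.
  have e2 : meanGap s (f (x + ε)) (f x) - σ * A * (ε ^ 2 * x⁻¹) =
      Q * x * (meanGap s (1 + ρ) 1 - σ * ρ ^ 2) + σ * (P ^ 2 / Q - A) * (ε ^ 2 * x⁻¹) := by
    rw [hgap, hρ]; field_simp; ring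
  have hw : 0 < ε ^ 2 * x⁻¹ := by positivity
  have b1 : |Q * x * (meanGap s (1 + ρ) 1 - σ * ρ ^ 2)| ≤ τ / 2 * (ε ^ 2 * x⁻¹) := by
    rw [abs_mul, abs_of_pos (by positivity)]
    calc Q * x * |meanGap s (1 + ρ) 1 - σ * ρ ^ 2| ≤ Q * x * ρ ^ 3 := by gcongr
      _ = P ^ 3 / Q ^ 2 * (ε / x) * (ε ^ 2 * x⁻¹) := by rw [hρ]; field_simp
      _ ≤ (3 / 2 * A) ^ 3 / (A / 2) ^ 2 * k * (ε ^ 2 * x⁻¹) := by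
          gcongr
          rw [div_le_iff₀ hx0]; exact hεx
      _ = k * (27 * A) / 2 * (ε ^ 2 * x⁻¹) := by field_simp; ring
      _ ≤ τ / 2 * (ε ^ 2 * x⁻¹) := by gcongr
  have b2 : |σ * (P ^ 2 / Q - A) * (ε ^ 2 * x⁻¹)| ≤ τ / 2 * (ε ^ 2 * x⁻¹) := by
    rw [abs_mul, abs_of_pos hw, abs_mul, abs_of_nonneg hσ0]
    gcongr
    refine (mul_le_of_le_one_left (abs_nonneg _) hσ1).trans ?_
    rw [show P ^ 2 / Q - A = (P ^ 2 - A * Q) / Q by field_simp, abs_div, abs_of_pos hQpos,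
      div_le_iff₀ hQpos]
    have hPA : |P - A| * (P + A) ≤ μ * A * (5 / 2 * A) :=
      mul_le_mul (abs_le.2 hP) (by linarith) (by positivity) hμA.le
    have hAQ : |A * (Q - A)| ≤ A * (μ * A) := by
      rw [abs_mul, abs_of_pos hA]
      exact mul_le_mul_of_nonneg_left (abs_le.2 hQ1) hA.le
    have hsum := abs_sub ((P - A) * (P + A)) (A * (Q - A))
    rw [abs_mul, abs_of_pos (by linarith : 0 < P + A)] at hsum
    rw [show P ^ 2 - A * Q = (P - A) * (P + A) - A * (Q - A) by ring]
    calc _ ≤ μ * A * (5 / 2 * A) + A * (μ * A) := hsum.trans (add_le_add hPA hAQ)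
      _ = μ * (14 * A) / 2 * (A / 2) := by ring
      _ ≤ τ / 2 * Q := by gcongr
  rw [e2]
  have := abs_add_le (Q * x * (meanGap s (1 + ρ) 1 - σ * ρ ^ 2))
    (σ * (P ^ 2 / Q - A) * (ε ^ 2 * x⁻¹))
  linarith

/-- The half-line is cut at `ε/k` and `η`. Only the middle range, where the gap is about `s(1-s)/2 ·
A ε²/x`, yields a logarithm. The mass of `(0, ε]`, the layer `(0, ε/k]` and the tail are all
`O(ε²)`. -/
lemma Admissible.exists_abs_deficit_sub_le (h : Admissible f A 2) {τ : ℝ} (hτ : 0 < τ) :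
    ∃ δ M : ℝ, 0 < δ ∧ δ < 1 ∧ ∀ ε ∈ Ioc 0 δ, ∀ s ∈ Ioo (0 : ℝ) 1,
      |deficit f ε s - A * s * (1 - s) / 2 * (-(ε ^ 2 * Real.log ε))| ≤
        ε ^ 2 * (τ * (-Real.log ε) + M) := by
  have hd := h.density
  have hA := h.endpoint.A_pos
  obtain ⟨η₁, k, hη₁, hk, hk1, hmid⟩ := h.exists_abs_meanGap_sub_le hτ
  obtain ⟨R, K, hR, hK, hnear⟩ := h.exists_near_bound
  have e1 : (2 : ℝ) - 1 = 1 := by norm_num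
  simp only [e1, Real.rpow_one] at hnear
  set η := min η₁ (min 1 (R / 3)) with hη
  have hη0 : 0 < η := by positivity
  have g1 : η ≤ η₁ := min_le_left _ _
  have g2 : η ≤ 1 := (min_le_right _ _).trans (min_le_left _ _)
  have g3 : η ≤ R / 3 := (min_le_right _ _).trans (min_le_right _ _)
  obtain ⟨C, δ₁, hδ₁, hC, htail⟩ := h.tail_isBigO hη0
  have hmass := tendsto_integral_Ioc_div hd.integrable h.endpoint.kappa_pos h.endpoint.equiv
  obtain ⟨δ₂, hδ₂, hmass'⟩ := mem_nhdsGT_iff_exists_Ioo_subset.1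
    (hmass.eventually (gt_mem_nhds (by linarith : A / 2 < A)))
  set B := ∫ y in Ioc 0 k⁻¹, scaleBound 1 y with hB
  have hδ₂ : 0 < δ₂ := hδ₂
  refine ⟨min (1 / 2) (min δ₁ (min (δ₂ / 2) (η * k))), A + K * B + C + (τ + A) * |Real.log (η * k)|,
    by positivity, (min_le_left _ _).trans_lt (by norm_num), fun ε hε s hs => ?_⟩
  have hε0 := hε.1
  have i1 : ε ≤ 1 / 2 := hε.2.trans (min_le_left _ _)
  have i2 : ε ≤ δ₁ := hε.2.trans ((min_le_right _ _).trans (min_le_left _ _))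
  have i3 : ε ≤ δ₂ / 2 :=
    hε.2.trans ((min_le_right _ _).trans ((min_le_right _ _).trans (min_le_left _ _)))
  have i4 : ε ≤ η * k :=
    hε.2.trans ((min_le_right _ _).trans ((min_le_right _ _).trans (min_le_right _ _)))
  have hεk : ε / k ≤ η := (div_le_iff₀ hk).2 i4
  have hεk0 : 0 < ε / k := by positivity
  have hi := integrable_meanGap_shift hd hs ε
  set σ := s * (1 - s) / 2 with hσ
  have hσ0 : 0 ≤ σ := by
    have : 0 ≤ s * (1 - s) := mul_nonneg hs.1.le (sub_nonneg.2 hs.2.le)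
    positivity
  have hσ1 : σ ≤ 1 := by rw [hσ]; nlinarith [hs.1, hs.2]
  have hF : |s * ∫ x in Ioc 0 ε, f x| ≤ ε ^ 2 * A := by
    have hF0 : 0 ≤ ∫ x in Ioc 0 ε, f x := integral_nonneg fun _ => hd.nonneg _
    have h1 : (∫ x in Ioc 0 ε, f x) / ε ^ (2 : ℝ) < A := hmass' ⟨hε0, by linarith⟩
    rw [Real.rpow_ofNat, div_lt_iff₀ (by positivity)] at h1
    rw [abs_of_nonneg (mul_nonneg hs.1.le hF0)]
    refine (mul_le_of_le_one_left hF0 hs.2.le).trans ?_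
    linarith
  have hN1 : |∫ x in Ioc 0 (ε / k), meanGap s (f (x + ε)) (f x)| ≤ ε ^ 2 * (K * B) := by
    rw [abs_of_nonneg (shift_integral_nonneg hd hs _)]
    -- Substituting `x = ε y` turns the layer into the fixed interval `(0, 1/k]`, so its
    -- contribution is a constant times `ε²`.
    have hcv : ∫ x in Ioc 0 (ε / k), scaleBound 1 (x / ε) = ε * B := by
      rw [← intervalIntegral.integral_of_le hεk0.le, intervalIntegral.integral_comp_div _ hε0.ne',
        hB, ← intervalIntegral.integral_of_le (by positivity), smul_eq_mul]
      congr 2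
      · simp
      · field_simp
    have hci : IntegrableOn (fun x => scaleBound 1 (x / ε)) (Ioc 0 (ε / k)) := by
      rw [← intervalIntegrable_iff_integrableOn_Ioc_of_le hεk0.le]
      have h1 : IntervalIntegrable (scaleBound 1) volume 0 k⁻¹ :=
        (intervalIntegrable_iff_integrableOn_Ioc_of_le (by positivity)).2
          (integrableOn_scaleBound_Ioc' (by norm_num) _)
      have h2 := h1.comp_mul_right (c := ε⁻¹) 
      simpa [div_eq_mul_inv, mul_comm] using h2
    calc ∫ x in Ioc 0 (ε / k), meanGap s (f (x + ε)) (f x)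
        ≤ ∫ x in Ioc 0 (ε / k), K * (ε * scaleBound 1 (x / ε)) :=
          setIntegral_mono_on hi.integrableOn ((hci.const_mul ε).const_mul K) measurableSet_Ioc
            fun x hx => hnear x ε s hx.1 hε0 (by
              have : ε ≤ η := i4.trans (mul_le_of_le_one_right hη0.le hk1)
              linarith [hx.2]) hs
      _ = ε ^ 2 * (K * B) := by
          rw [integral_const_mul, integral_const_mul, hcv]; ring
  set ℓ := Real.log (η * k) with hℓ
  have hinv : IntervalIntegrable (fun x : ℝ => x⁻¹) volume (ε / k) η := by
    refine intervalIntegral.intervalIntegrable_inv (fun x hx => ?_) continuousOn_id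
    rw [uIcc_of_le hεk] at hx
    exact (hεk0.trans_le hx.1).ne'
  have hinv' : IntegrableOn (fun x : ℝ => ε ^ 2 * x⁻¹) (Ioc (ε / k) η) :=
    ((intervalIntegrable_iff_integrableOn_Ioc_of_le hεk).1 hinv).const_mul _
  have hlog : ∫ x in Ioc (ε / k) η, ε ^ 2 * x⁻¹ = ε ^ 2 * (-Real.log ε + ℓ) := by
    rw [integral_const_mul, ← intervalIntegral.integral_of_le hεk, integral_inv_of_pos hεk0 hη0,
      hℓ, div_div_eq_mul_div, Real.log_div (by positivity) hε0.ne']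
    ring
  have hN2 : |(∫ x in Ioc (ε / k) η, meanGap s (f (x + ε)) (f x)) -
      σ * A * (ε ^ 2 * (-Real.log ε + ℓ))| ≤ τ * (ε ^ 2 * (-Real.log ε + ℓ)) := by
    rw [← hlog, ← integral_const_mul, ← integral_const_mul,
      ← integral_sub hi.integrableOn (hinv'.const_mul _)]
    refine (Real.norm_eq_abs _).symm.trans_le
      (norm_integral_le_of_norm_le (hinv'.const_mul τ) ?_)
    refine (ae_restrict_iff' measurableSet_Ioc).2 (Eventually.of_forall fun x hx => ?_)
    refine hmid x ⟨hεk0.trans hx.1, hx.2.trans g1⟩ ε hε0 ?_ s hs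
    rw [mul_comm]
    exact ((div_lt_iff₀ hk).1 hx.1).le
  have hT := htail ε ⟨hε0, i2⟩ s hs
  have hsplit : ∫ x in Ioc 0 η, meanGap s (f (x + ε)) (f x) =
      (∫ x in Ioc 0 (ε / k), meanGap s (f (x + ε)) (f x)) +
        ∫ x in Ioc (ε / k) η, meanGap s (f (x + ε)) (f x) := by
    rw [← Ioc_union_Ioc_eq_Ioc hεk0.le hεk]
    exact setIntegral_union (Ioc_disjoint_Ioc_of_le le_rfl) measurableSet_Ioc
      hi.integrableOn hi.integrableOn
  rw [deficit_eq hd hη0 hs, hsplit]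
  set F := s * ∫ x in Ioc 0 ε, f x
  set N1 := ∫ x in Ioc 0 (ε / k), meanGap s (f (x + ε)) (f x)
  set N2 := ∫ x in Ioc (ε / k) η, meanGap s (f (x + ε)) (f x)
  set T := ∫ x in Ioi η, meanGap s (f (x + ε)) (f x)
  have e : F + (N1 + N2) + T - A * s * (1 - s) / 2 * (-(ε ^ 2 * Real.log ε)) =
      F + N1 + T + ((N2 - σ * A * (ε ^ 2 * (-Real.log ε + ℓ))) + σ * A * (ε ^ 2 * ℓ)) := by
    rw [hσ]; ring
  have c1 : |σ * A * (ε ^ 2 * ℓ)| ≤ A * (ε ^ 2 * |ℓ|) := by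
    rw [abs_mul, abs_mul (ε ^ 2), abs_of_nonneg (by positivity), abs_of_pos (by positivity :
      0 < ε ^ 2)]
    gcongr
    exact mul_le_of_le_one_left hA.le hσ1
  have c2 : τ * (ε ^ 2 * (-Real.log ε + ℓ)) ≤ τ * (ε ^ 2 * (-Real.log ε + |ℓ|)) := by
    gcongr; exact le_abs_self _
  rw [e]
  have d1 := abs_add_le (F + N1 + T)
    ((N2 - σ * A * (ε ^ 2 * (-Real.log ε + ℓ))) + σ * A * (ε ^ 2 * ℓ))
  have d2 := abs_add_le (N2 - σ * A * (ε ^ 2 * (-Real.log ε + ℓ))) (σ * A * (ε ^ 2 * ℓ))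
  have d3 := abs_add_le (F + N1) T
  have d4 := abs_add_le F N1
  calc _ ≤ ε ^ 2 * A + ε ^ 2 * (K * B) + C * ε ^ 2 +
        (τ * (ε ^ 2 * (-Real.log ε + |ℓ|)) + A * (ε ^ 2 * |ℓ|)) := by linarith
    _ = _ := by ring

/-- After division by `-ε² log ε` the constant `M` is negligible, and the coefficient of the
logarithmic error is at most half the prescribed tolerance. -/
lemma Admissible.tendsto_deficit_of_eq_two (h : Admissible f A 2) :
    Tendsto (fun q : ℝ × ℝ => deficit f q.1 q.2 / (-(q.1 ^ 2 * Real.log q.1)) -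
      A * q.2 * (1 - q.2) / 2) shiftFilter (𝓝 0) := by
  rw [Metric.tendsto_nhds]
  intro τ hτ
  obtain ⟨δ, M, hδ, hδ1, hb⟩ := h.exists_abs_deficit_sub_le (half_pos hτ)
  have hlog : ∀ᶠ ε in 𝓝[>] (0 : ℝ), Real.log ε < -(2 * |M| / τ) :=
    Real.tendsto_log_nhdsGT_zero.eventually (eventually_lt_atBot _)
  refine eventually_shiftFilter (P := fun ε s =>
    dist (deficit f ε s / (-(ε ^ 2 * Real.log ε)) - A * s * (1 - s) / 2) 0 < τ) ?_
  filter_upwards [hlog, Ioc_mem_nhdsGT hδ] with ε a1 a2 s hs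
  have hε := a2.1
  have hL : 0 < -Real.log ε := by
    have := Real.log_neg hε (a2.2.trans_lt hδ1); linarith
  have hφ : 0 < -(ε ^ 2 * Real.log ε) := by
    have := mul_pos (pow_pos hε 2) hL; linarith
  have h1 := hb ε a2 s hs
  rw [dist_zero_right, Real.norm_eq_abs, show deficit f ε s / (-(ε ^ 2 * Real.log ε)) -
    A * s * (1 - s) / 2 = (deficit f ε s - A * s * (1 - s) / 2 * (-(ε ^ 2 * Real.log ε))) /
      (-(ε ^ 2 * Real.log ε)) by rw [sub_div, mul_div_cancel_right₀ _ hφ.ne'], abs_div,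
    abs_of_pos hφ, div_lt_iff₀ hφ]
  refine h1.trans_lt ?_
  have h2 : M < τ / 2 * (-Real.log ε) := by
    have : 2 * |M| / τ < -Real.log ε := by linarith
    rw [div_lt_iff₀ hτ] at this
    linarith [le_abs_self M]
  calc ε ^ 2 * (τ / 2 * (-Real.log ε) + M) < ε ^ 2 * (τ / 2 * (-Real.log ε) +
        τ / 2 * (-Real.log ε)) := by gcongr
    _ = _ := by ring

/-! ### Uniform limits of the relative Rényi entropy -/

lemma UniformLimit.congr {R : ℝ → ℝ → ℝ} {L L' : ℝ → ℝ} (h : UniformLimit R L)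
    (hL : ∀ s ∈ Ioo (0 : ℝ) 1, L s = L' s) : UniformLimit R L' :=
  TendstoUniformlyOn.congr_right h hL

lemma Admissible.uniformLimit_of_lt_two (h : Admissible f A κ) (hκ2 : κ < 2) (θ : ℝ) :
    UniformLimit (fun ε s => relRenyi s (shift f θ) (shift f (θ + ε)) / ε ^ κ)
      (fun s => A * s * (1 - s * (κ - 1)) *
        ProbabilityTheory.beta (s + κ * (1 - s)) (2 - κ) / κ) := by
  obtain ⟨M, hM⟩ := exists_abs_beta_le (A := A) h.endpoint.kappa_pos hκ2
  refine uniformLimit_of_tendsto_deficit h.density ?_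
    (tendsto_rpow_nhdsGT_zero h.endpoint.kappa_pos) hM (h.tendsto_deficit_of_lt_two hκ2) θ
  filter_upwards [self_mem_nhdsWithin] with ε hε
  exact Real.rpow_pos_of_pos hε κ

lemma beta_add_one_right {a b : ℝ} (ha : 0 < a) (hb : 0 < b) :
    (a + b) * ProbabilityTheory.beta a (b + 1) = b * ProbabilityTheory.beta a b := by
  have h1 := Real.Gamma_pos_of_pos (add_pos ha hb)
  rw [ProbabilityTheory.beta, ProbabilityTheory.beta, Real.Gamma_add_one hb.ne', ← add_assoc,
    Real.Gamma_add_one (add_pos ha hb).ne']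
  field_simp

lemma Admissible.uniformLimit_of_lt_one (h : Admissible f A κ) (hκ : κ < 1) (θ : ℝ) :
    UniformLimit (fun ε s => relRenyi s (shift f θ) (shift f (θ + ε)) / ε ^ κ)
      (fun s => (1 - κ) / κ * (A * s * ProbabilityTheory.beta (s + κ * (1 - s)) (1 - κ))) := by
  refine (h.uniformLimit_of_lt_two (by linarith) θ).congr fun s hs => ?_
  have hκ0 := h.endpoint.kappa_pos
  have ha : 0 < s + κ * (1 - s) := by
    have := mul_pos hκ0 (sub_pos.2 hs.2)
    linarith [hs.1]
  -- For `κ < 1` the factor `1 - s(κ-1)` is the sum of the two beta arguments, so the recursion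
  -- absorbs it and lowers `2 - κ` to `1 - κ`.
  have hb := beta_add_one_right ha (sub_pos.2 hκ)
  rw [show 1 - κ + 1 = 2 - κ by ring,
    show s + κ * (1 - s) + (1 - κ) = 1 - s * (κ - 1) by ring] at hb
  linear_combination (A * s / κ) * hb

lemma Admissible.uniformLimit_of_eq_one (h : Admissible f A κ) (hκ : κ = 1) (θ : ℝ) :
    UniformLimit (fun ε s => relRenyi s (shift f θ) (shift f (θ + ε)) / ε ^ κ)
      (fun s => A * s) := by
  refine (h.uniformLimit_of_lt_two (by linarith) θ).congr fun s hs => ?_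
  have e1 : s + 1 * (1 - s) = 1 := by ring
  have e2 : (2 : ℝ) - 1 = 1 := by norm_num
  have e3 : (1 : ℝ) + 1 = 2 := by norm_num
  rw [hκ, e1, e2, ProbabilityTheory.beta, e3, Real.Gamma_one, Real.Gamma_two]
  ring

lemma Admissible.uniformLimit_of_eq_two (h : Admissible f A κ) (hκ : κ = 2) (θ : ℝ) :
    UniformLimit (fun ε s => relRenyi s (shift f θ) (shift f (θ + ε)) /
      (-(ε ^ 2 * Real.log ε))) (fun s => A * s * (1 - s) / 2) := by
  subst hκ
  refine uniformLimit_of_tendsto_deficit h.density (φ := fun ε => -(ε ^ 2 * Real.log ε)) ?_ ?_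
    (M := A) ?_ h.tendsto_deficit_of_eq_two θ
  · filter_upwards [Ioo_mem_nhdsGT one_pos] with ε hε
    have := mul_pos_of_neg_of_neg (neg_lt_zero.2 (pow_pos hε.1 2)) (Real.log_neg hε.1 hε.2)
    linarith
  · have := (tendsto_log_mul_rpow_nhdsGT_zero (by norm_num : (0 : ℝ) < 2)).neg
    simpa [mul_comm] using this
  · intro s hs
    have hA := h.endpoint.A_pos
    have h0 : 0 ≤ s * (1 - s) := mul_nonneg hs.1.le (sub_nonneg.2 hs.2.le)
    have h1 : s * (1 - s) ≤ 1 := by nlinarith [hs.1, hs.2]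
    rw [show A * s * (1 - s) / 2 = A * (s * (1 - s)) / 2 by ring, abs_of_nonneg (by positivity)]
    nlinarith

lemma Admissible.uniformLimit_of_two_lt (h : Admissible f A κ) (hκ : 2 < κ) (θ : ℝ) :
    UniformLimit (fun ε s => relRenyi s (shift f θ) (shift f (θ + ε)) / ε ^ 2)
      (fun s => s * (1 - s) / 2 * fisherInfo f) := by
  refine uniformLimit_of_tendsto_deficit h.density (φ := fun ε => ε ^ 2) ?_ ?_
    (M := |fisherInfo f|) ?_ (h.tendsto_deficit_of_two_lt hκ) θ
  · filter_upwards [self_mem_nhdsWithin] with ε hε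
    exact pow_pos hε 2
  · simpa using tendsto_rpow_nhdsGT_zero (p := 2) (by norm_num)
  · intro s hs
    have h0 : 0 ≤ s * (1 - s) := mul_nonneg hs.1.le (sub_nonneg.2 hs.2.le)
    have h1 : s * (1 - s) / 2 ≤ 1 := by nlinarith [hs.1, hs.2]
    rw [abs_mul, abs_of_nonneg (by positivity)]
    exact mul_le_of_le_one_left (abs_nonneg _) h1

end Admissible

/-! ### Suprema over shifts -/

/-- A supremum of a jointly continuous function over a compact parameter set. It supplies the
measurability behind the comparison in `integrableOn_supShift_mul`. -/
lemma continuousOn_supShift {g : ℝ → ℝ} (hg : ContinuousOn g (Ioi 0)) (δ : ℝ) :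
    ContinuousOn (supShift δ g) (Ioi 0) := by
  rw [continuousOn_iff_continuous_domRestrict]
  have hc : Continuous (fun z : Ioi (0 : ℝ) × Icc (0 : ℝ) δ => g (z.1 + z.2)) := by
    refine hg.comp_continuous (by fun_prop) fun z => ?_
    have h1 : (0 : ℝ) < z.1 := z.1.2
    have h2 : (0 : ℝ) ≤ z.2 := z.2.2.1
    exact add_pos_of_pos_of_nonneg h1 h2
  have := (isCompact_univ (X := Icc (0 : ℝ) δ)).continuous_sSup
    (f := fun (x : Ioi (0 : ℝ)) (t : Icc (0 : ℝ) δ) => g (x + t)) hc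
  convert! this using 2 with x
  simp only [domRestrict_apply, supShift, image_univ, sSup_range]

lemma integrableOn_supShift_mul {g h G : ℝ → ℝ} {c δ : ℝ} (hc : 0 < c)
    (hg : ContinuousOn g (Ioi 0)) (hh : ContinuousOn h (Ioi 0)) (hg0 : ∀ x, 0 < x → 0 ≤ g x)
    (hh0 : ∀ x, 0 < x → 0 ≤ h x) {H : ℝ → ℝ} (hG0 : ∀ x, c < x → 0 ≤ G x)
    (hH0 : ∀ x, c < x → 0 ≤ H x)
    (hG : ∀ x, c < x → ∀ t ∈ Icc 0 δ, g (x + t) ≤ G x)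
    (hH : ∀ x, c < x → ∀ t ∈ Icc 0 δ, h (x + t) ≤ H x)
    (hi : IntegrableOn (fun x => G x * H x) (Ioi c)) :
    IntegrableOn (fun x => supShift δ g x * supShift δ h x) (Ioi c) := by
  have hsub : Ioi c ⊆ Ioi (0 : ℝ) := Ioi_subset_Ioi hc.le
  refine Integrable.mono' hi ((((continuousOn_supShift hg δ).mul
    (continuousOn_supShift hh δ)).mono hsub).aestronglyMeasurable measurableSet_Ioi) ?_
  refine (ae_restrict_iff' measurableSet_Ioi).2 (Eventually.of_forall fun x hx => ?_)
  have hx : c < x := hx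
  have hpos : ∀ t : Icc (0 : ℝ) δ, 0 < x + t := fun t => by linarith [t.2.1]
  have a1 : 0 ≤ supShift δ g x := Real.iSup_nonneg fun t => hg0 _ (hpos t)
  have a2 : 0 ≤ supShift δ h x := Real.iSup_nonneg fun t => hh0 _ (hpos t)
  have b1 : supShift δ g x ≤ G x := Real.iSup_le (fun t => hG x hx t t.2) (hG0 x hx)
  have b2 : supShift δ h x ≤ H x := Real.iSup_le (fun t => hH x hx t t.2) (hH0 x hx)
  rw [Real.norm_of_nonneg (mul_nonneg a1 a2)]
  exact mul_le_mul b1 b2 a2 (a1.trans b1)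

/-! ### Generalized gamma densities -/

/-- The function `C x^(α-1) exp(-β x^γ)` on the half-line. -/
noncomputable def genGamma (C α β γ x : ℝ) : ℝ :=
  if 0 ≤ x then C * x ^ (α - 1) * Real.exp (-(β * x ^ γ)) else 0

namespace genGamma

variable {C α β γ : ℝ}

/-- The function `x f'(x) / f(x)`. -/
noncomputable def ratio₁ (α β γ x : ℝ) : ℝ := α - 1 - β * γ * x ^ γ

/-- The function `x² f''(x) / f(x)`. -/
noncomputable def ratio₂ (α β γ x : ℝ) : ℝ :=
  ratio₁ α β γ x * (ratio₁ α β γ x - 1) - β * γ * γ * x ^ γ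

/-- The function `x³ f'''(x) / f(x)`. -/
noncomputable def ratio₃ (α β γ x : ℝ) : ℝ :=
  ratio₂ α β γ x * (ratio₁ α β γ x - 2) -
    β * γ * γ * x ^ γ * (2 * ratio₁ α β γ x - 1 + γ)

lemma of_pos {x : ℝ} (hx : 0 < x) :
    genGamma C α β γ x = C * x ^ (α - 1) * Real.exp (-(β * x ^ γ)) := by
  simp [genGamma, hx.le]

lemma eventuallyEq {x : ℝ} (hx : 0 < x) : genGamma C α β γ =ᶠ[𝓝 x]
    fun x => C * x ^ (α - 1) * Real.exp (-(β * x ^ γ)) := by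
  filter_upwards [Ioi_mem_nhds hx] with y hy
  exact of_pos hy

lemma hasDerivAt_rpow_mul {x : ℝ} (hx : 0 < x) :
    HasDerivAt (fun x : ℝ => x ^ γ) (γ * (x ^ γ / x)) x := by
  have h := Real.hasDerivAt_rpow_const (p := γ) (Or.inl hx.ne')
  rwa [Real.rpow_sub hx, Real.rpow_one] at h

lemma hasDerivAt {x : ℝ} (hx : 0 < x) :
    HasDerivAt (genGamma C α β γ) (genGamma C α β γ x * ratio₁ α β γ x / x) x := by
  have h := (((hasDerivAt_rpow_mul (γ := α - 1) hx).const_mul C).mul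
    (((hasDerivAt_rpow_mul (γ := γ) hx).const_mul β).neg.exp))
  refine (h.congr_of_eventuallyEq (eventuallyEq hx)).congr_deriv ?_
  rw [of_pos hx, ratio₁]
  simp only [Pi.neg_apply]
  field_simp
  ring

/-- Differentiation of `f q / x^k` for the density `f`. -/
lemma hasDerivAt_mul_div {q : ℝ → ℝ} {q' x : ℝ} (hx : 0 < x) (k : ℕ) (hq : HasDerivAt q (q' / x) x) :
    HasDerivAt (fun x => genGamma C α β γ x * q x / x ^ k)
      (genGamma C α β γ x * (q x * (ratio₁ α β γ x - k) + q') / x ^ (k + 1)) x := by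
  have h := ((hasDerivAt (C := C) (α := α) (β := β) (γ := γ) hx).mul hq).div (hasDerivAt_pow k x)
    (pow_ne_zero k hx.ne')
  refine h.congr_deriv ?_
  simp only [Pi.mul_apply]
  rcases k with _ | k
  · simp; field_simp
  · simp only [Nat.add_sub_cancel]
    field_simp
    ring

lemma hasDerivAt_ratio₁ {x : ℝ} (hx : 0 < x) :
    HasDerivAt (ratio₁ α β γ) (-(β * γ * γ * x ^ γ) / x) x := by
  have h := ((hasDerivAt_rpow_mul (γ := γ) hx).const_mul (β * γ)).const_sub (α - 1)
  refine h.congr_deriv ?_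
  ring

lemma hasDerivAt_ratio₂ {x : ℝ} (hx : 0 < x) :
    HasDerivAt (ratio₂ α β γ) (-(β * γ * γ * x ^ γ * (2 * ratio₁ α β γ x - 1 + γ)) / x) x := by
  have h1 := hasDerivAt_ratio₁ (α := α) (β := β) (γ := γ) hx
  have h := (h1.mul (h1.sub_const 1)).sub
    ((hasDerivAt_rpow_mul (γ := γ) hx).const_mul (β * γ * γ))
  refine h.congr_deriv ?_
  ring

lemma deriv_eq {x : ℝ} (hx : 0 < x) :
    deriv (genGamma C α β γ) x = genGamma C α β γ x * ratio₁ α β γ x / x :=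
  (hasDerivAt hx).deriv

lemma iteratedDeriv_two_eq {x : ℝ} (hx : 0 < x) :
    iteratedDeriv 2 (genGamma C α β γ) x = genGamma C α β γ x * ratio₂ α β γ x / x ^ 2 := by
  rw [iteratedDeriv_succ, iteratedDeriv_one]
  have h := hasDerivAt_mul_div (C := C) (α := α) (β := β) (γ := γ) hx 1
    (hasDerivAt_ratio₁ (α := α) (β := β) (γ := γ) hx)
  have he : deriv (genGamma C α β γ) =ᶠ[𝓝 x]
      fun x => genGamma C α β γ x * ratio₁ α β γ x / x ^ 1 := by
    filter_upwards [Ioi_mem_nhds hx] with y hy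
    rw [deriv_eq hy, pow_one]
  rw [(h.congr_of_eventuallyEq he).deriv, ratio₂]
  push_cast
  ring

lemma iteratedDeriv_three_eq {x : ℝ} (hx : 0 < x) :
    iteratedDeriv 3 (genGamma C α β γ) x = genGamma C α β γ x * ratio₃ α β γ x / x ^ 3 := by
  rw [iteratedDeriv_succ]
  have h := hasDerivAt_mul_div (C := C) (α := α) (β := β) (γ := γ) hx 2
    (hasDerivAt_ratio₂ (α := α) (β := β) (γ := γ) hx)
  have he : iteratedDeriv 2 (genGamma C α β γ) =ᶠ[𝓝 x]
      fun x => genGamma C α β γ x * ratio₂ α β γ x / x ^ 2 := by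
    filter_upwards [Ioi_mem_nhds hx] with y hy
    rw [iteratedDeriv_two_eq hy]
  rw [(h.congr_of_eventuallyEq he).deriv, ratio₃]
  push_cast
  ring

lemma pos (hC : 0 < C) {x : ℝ} (hx : 0 < x) : 0 < genGamma C α β γ x := by
  rw [of_pos hx]; positivity

lemma contDiffOn : ContDiffOn ℝ 3 (genGamma C α β γ) (Ioi 0) := by
  have hr : ∀ p : ℝ, ContDiffOn ℝ 3 (fun x : ℝ => x ^ p) (Ioi 0) := fun p =>
    contDiffOn_id.rpow_const_of_ne fun x hx => ne_of_gt hx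
  refine ContDiffOn.congr (f := fun x => C * x ^ (α - 1) * Real.exp (-(β * x ^ γ))) ?_
    fun x hx => of_pos hx
  exact (contDiffOn_const.mul (hr _)).mul (contDiffOn_const.mul (hr γ)).neg.exp

/-- Again a nonzero value of the integral, here a gamma function times positive factors, forces
integrability. -/
lemma integrableOn_rpow_mul_exp (hβ : 0 < β) (hγ : 0 < γ) {p : ℝ} (hp : -1 < p) :
    IntegrableOn (fun x : ℝ => x ^ p * Real.exp (-(β * x ^ γ))) (Ioi 0) := by
  refine not_imp_comm.1 integral_undef ?_
  have h := integral_rpow_mul_exp_neg_mul_rpow hγ hp hβ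
  simp only [neg_mul] at h
  rw [h]
  have : 0 < Real.Gamma ((p + 1) / γ) := Real.Gamma_pos_of_pos (div_pos (by linarith) hγ)
  positivity

lemma integral_Ioi (hβ : 0 < β) (hγ : 0 < γ) (hα : 0 < α) :
    ∫ x in Ioi 0, genGamma C α β γ x = C * (β ^ (-α / γ) * (1 / γ) * Real.Gamma (α / γ)) := by
  have h := integral_rpow_mul_exp_neg_mul_rpow hγ (by linarith : -1 < α - 1) hβ
  simp only [neg_mul, sub_add_cancel] at h
  rw [← h, ← integral_const_mul]
  refine setIntegral_congr_fun measurableSet_Ioi fun x hx => ?_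
  simp only [of_pos (mem_Ioi.1 hx), mul_assoc]

lemma isHalfLineDensity (hC : 0 < C) (hα : 0 < α) (hβ : 0 < β) (hγ : 0 < γ)
    (h1 : C * (β ^ (-α / γ) * (1 / γ) * Real.Gamma (α / γ)) = 1) :
    IsHalfLineDensity (genGamma C α β γ) where
  nonneg x := by
    unfold genGamma; split_ifs <;> positivity
  eq_zero x hx := by simp [genGamma, hx]
  pos x hx := pos hC hx
  integrable := by
    rw [← integrableOn_univ, ← Iic_union_Ioi (a := (0 : ℝ))]
    refine IntegrableOn.union ?_ ?_
    · rw [integrableOn_Iic_iff_integrableOn_Iio]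
      refine IntegrableOn.congr_fun (f := fun _ => (0 : ℝ)) (by simp) (fun x hx => ?_) measurableSet_Iio
      simp [genGamma, mem_Iio.1 hx]
    · refine IntegrableOn.congr_fun ((integrableOn_rpow_mul_exp hβ hγ
        (by linarith : -1 < α - 1)).const_mul C) (fun x hx => ?_) measurableSet_Ioi
      simp only [of_pos (mem_Ioi.1 hx), mul_assoc]
  integral_eq_one := by
    rw [← h1, ← integral_Ioi hβ hγ hα, ← integral_Ici_eq_integral_Ioi,
      setIntegral_eq_integral_of_forall_compl_eq_zero]
    intro x hx
    have hx : ¬ 0 ≤ x := hx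
    simp [genGamma, hx]
  contDiffOn := contDiffOn

lemma tendsto_exp (hγ : 0 < γ) :
    Tendsto (fun x : ℝ => Real.exp (-(β * x ^ γ))) (𝓝[>] 0) (𝓝 1) := by
  simpa using ((tendsto_rpow_nhdsGT_zero hγ).const_mul β).neg.rexp

lemma tendsto_ratio₁ (hγ : 0 < γ) : Tendsto (ratio₁ α β γ) (𝓝[>] 0) (𝓝 (α - 1)) := by
  have h := ((tendsto_rpow_nhdsGT_zero hγ).const_mul (β * γ)).const_sub (α - 1)
  rw [mul_zero, sub_zero] at h
  exact h

lemma tendsto_ratio₂ (hγ : 0 < γ) :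
    Tendsto (ratio₂ α β γ) (𝓝[>] 0) (𝓝 ((α - 1) * (α - 2))) := by
  have h1 := tendsto_ratio₁ (α := α) (β := β) hγ
  have h := (h1.mul (h1.sub_const 1)).sub ((tendsto_rpow_nhdsGT_zero hγ).const_mul (β * γ * γ))
  convert! h using 2
  ring

/-- Near `0` each derivative is `C x^(α-1-k)` times the exponential and a ratio with an explicit
limit. For `α = 1` the limit of `ratio₁` is zero and the next order matters: `f'` behaves like
`x^(γ-1)`, which blows up for `γ < 1`. The case `γ = 1` covers both examples. -/
lemma endpointCondition (hC : 0 < C) (hα : 0 < α) (hγ : 0 < γ) (h1 : α = 1 → γ = 1) :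
    EndpointCondition (genGamma C α β γ) C α where
  A_pos := hC
  kappa_pos := hα
  equiv := by
    refine isEquivalent_iff_exists_eq_mul.2 ⟨_, tendsto_exp (β := β) hγ, ?_⟩
    filter_upwards [self_mem_nhdsWithin] with x hx
    rw [of_pos hx, Pi.mul_apply, mul_comm]
  equiv_deriv hκ := by
    have hκ' : α - 1 ≠ 0 := sub_ne_zero.2 hκ
    have h := (tendsto_exp (β := β) hγ).mul
      ((tendsto_ratio₁ (α := α) (β := β) hγ).div_const (α - 1))
    rw [div_self hκ', mul_one] at h
    refine isEquivalent_iff_exists_eq_mul.2 ⟨_, h, ?_⟩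
    filter_upwards [self_mem_nhdsWithin] with x hx
    have hx : 0 < x := hx
    rw [deriv_eq hx, of_pos hx, Pi.mul_apply, Real.rpow_sub hx α 1, Real.rpow_sub hx α 2,
      Real.rpow_one, Real.rpow_ofNat]
    field_simp
  equiv_deriv2 hκ hκ2 := by
    have hκ' : α - 1 ≠ 0 := sub_ne_zero.2 hκ
    have hκ2' : α - 2 ≠ 0 := sub_ne_zero.2 hκ2
    have h := (tendsto_exp (β := β) hγ).mul
      ((tendsto_ratio₂ (α := α) (β := β) hγ).div_const ((α - 1) * (α - 2)))
    rw [div_self (mul_ne_zero hκ' hκ2'), mul_one] at h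
    refine isEquivalent_iff_exists_eq_mul.2 ⟨_, h, ?_⟩
    filter_upwards [self_mem_nhdsWithin] with x hx
    have hx : 0 < x := hx
    rw [iteratedDeriv_two_eq hx, of_pos hx, Pi.mul_apply, Real.rpow_sub hx α 1,
      Real.rpow_sub hx α 3, Real.rpow_one, Real.rpow_ofNat]
    field_simp
  tendsto_of_two hκ := by
    have h := ((tendsto_exp (β := β) hγ).mul (tendsto_ratio₂ (α := α) (β := β) hγ)).const_mul C
    -- At `α = 2` the limit `(α-1)(α-2)` of `ratio₂` vanishes.
    rw [hκ, sub_self, mul_zero, mul_zero, mul_zero, ← hκ] at h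
    refine h.congr' ?_
    filter_upwards [self_mem_nhdsWithin] with x hx
    have hx : 0 < x := hx
    rw [iteratedDeriv_two_eq hx, of_pos hx, show α - 1 = 1 by linarith, Real.rpow_one]
    field_simp
  limit_deriv_of_one hκ := by
    have hγ1 := h1 hκ
    refine ⟨_, ((tendsto_exp (β := β) hγ).const_mul (-(C * β))).congr' ?_⟩
    filter_upwards [self_mem_nhdsWithin] with x hx
    have hx : 0 < x := hx
    rw [deriv_eq hx, of_pos hx, ratio₁, hκ, hγ1, sub_self, Real.rpow_zero, Real.rpow_one]
    field_simp
    ring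
  limit_deriv2_of_one hκ := by
    have hγ1 := h1 hκ
    refine ⟨_, ((tendsto_exp (β := β) hγ).const_mul (C * β ^ 2)).congr' ?_⟩
    filter_upwards [self_mem_nhdsWithin] with x hx
    have hx : 0 < x := hx
    rw [iteratedDeriv_two_eq hx, of_pos hx, ratio₂, ratio₁, hκ, hγ1, sub_self, Real.rpow_zero,
      Real.rpow_one]
    field_simp
    ring

/-- The ratios are polynomials of degrees `1`, `2` and `3` in `x^γ`, and `x^γ ≥ 1` lets the top
power absorb the lower ones. -/
lemma exists_ratio_bounds (hβ : 0 < β) (hγ : 0 < γ) : ∃ B, 0 < B ∧ ∀ x : ℝ, 1 ≤ x →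
    |ratio₁ α β γ x| ≤ B * x ^ γ ∧ |ratio₂ α β γ x| ≤ B * (x ^ γ) ^ 2 ∧
      |ratio₃ α β γ x| ≤ B * (x ^ γ) ^ 3 := by
  set b := β * γ with hb
  have hb0 : 0 < b := mul_pos hβ hγ
  set B₁ := |α - 1| + b with hB₁
  have hB₁0 : 0 < B₁ := by positivity
  set B₂ := B₁ ^ 2 + B₁ + b * γ with hB₂
  have hB₂0 : 0 < B₂ := by positivity
  set B₃ := B₂ * (B₁ + 2) + b * γ * (2 * B₁ + 1 + γ) with hB₃
  have hB₃0 : 0 < B₃ := by positivity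
  refine ⟨B₁ + B₂ + B₃, by positivity, fun x hx => ?_⟩
  have hv : 1 ≤ x ^ γ := Real.one_le_rpow hx hγ.le
  have r1 : |ratio₁ α β γ x| ≤ B₁ * x ^ γ := by
    refine (abs_sub _ _).trans ?_
    rw [abs_of_pos (by positivity : 0 < β * γ * x ^ γ), hB₁, add_mul]
    gcongr
    exact le_mul_of_one_le_right (abs_nonneg _) hv
  have r2 : |ratio₂ α β γ x| ≤ B₂ * (x ^ γ) ^ 2 := by
    unfold ratio₂
    set q := ratio₁ α β γ x
    set v := x ^ γ
    have h1 : |q * (q - 1)| ≤ B₁ * v * (B₁ * v + 1) := by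
      rw [abs_mul]
      gcongr
      refine (abs_sub _ _).trans ?_
      rw [abs_one]; gcongr
    refine (abs_sub _ _).trans ?_
    rw [abs_of_pos (by positivity : 0 < β * γ * γ * v)]
    have hv2 : v ≤ v ^ 2 := by nlinarith
    calc _ ≤ B₁ * v * (B₁ * v + 1) + b * γ * v := by gcongr
      _ = B₁ ^ 2 * v ^ 2 + B₁ * v + b * γ * v := by ring
      _ ≤ B₁ ^ 2 * v ^ 2 + B₁ * v ^ 2 + b * γ * v ^ 2 := by gcongr
      _ = B₂ * v ^ 2 := by rw [hB₂]; ring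
  have r3 : |ratio₃ α β γ x| ≤ B₃ * (x ^ γ) ^ 3 := by
    unfold ratio₃
    set q := ratio₁ α β γ x
    set q2 := ratio₂ α β γ x
    set v := x ^ γ
    have h1 : |q2 * (q - 2)| ≤ B₂ * v ^ 2 * (B₁ * v + 2) := by
      rw [abs_mul]
      gcongr
      refine (abs_sub _ _).trans ?_
      rw [abs_two]; gcongr
    have h2 : |2 * q - 1 + γ| ≤ 2 * (B₁ * v) + 1 + γ := by
      refine (abs_add_le _ _).trans ?_
      rw [abs_of_pos hγ]
      gcongr
      refine (abs_sub _ _).trans ?_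
      rw [abs_mul, abs_two, abs_one]
      gcongr
    refine (abs_sub _ _).trans ?_
    rw [abs_mul (β * γ * γ * v), abs_of_pos (by positivity : 0 < β * γ * γ * v)]
    have hv0 : 0 ≤ v - 1 := sub_nonneg.2 hv
    have hv3 : v ^ 2 ≤ v ^ 3 := pow_le_pow_right₀ hv (by norm_num)
    have hv2 : v ≤ v ^ 3 := le_self_pow₀ hv (by norm_num)
    calc _ ≤ B₂ * v ^ 2 * (B₁ * v + 2) + b * γ * v * (2 * (B₁ * v) + 1 + γ) := by gcongr
      _ = B₂ * B₁ * v ^ 3 + 2 * B₂ * v ^ 2 + (b * γ * (2 * B₁) * v ^ 2 + b * γ * (1 + γ) * v) := by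
        ring
      _ ≤ B₂ * B₁ * v ^ 3 + 2 * B₂ * v ^ 3 + (b * γ * (2 * B₁) * v ^ 3 + b * γ * (1 + γ) * v ^ 3) := by
        gcongr
      _ = B₃ * v ^ 3 := by rw [hB₃]; ring
  refine ⟨r1.trans ?_, r2.trans ?_, r3.trans ?_⟩ <;> gcongr <;> linarith

/-- With `c = δ = 1`, a shifted point lies in `[x, 2x]`. The supremum of the density is then at most
a power of `x` times `exp(-β x^γ)`, the quotients grow at most polynomially, and the exponential
makes every product integrable. -/
lemma tailCondition (hC : 0 < C) (hβ : 0 < β) (hγ : 0 < γ) :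
    TailCondition (genGamma C α β γ) := by
  obtain ⟨B, hB, hr⟩ := exists_ratio_bounds (α := α) hβ hγ
  have hf := contDiffOn (C := C) (α := α) (β := β) (γ := γ)
  have hcf := hf.continuousOn
  have hcf1 := (HalfLine.contDiffOn_deriv hf).continuousOn
  have hcf2 := (HalfLine.contDiffOn_deriv2 hf).continuousOn
  have hcf3 := HalfLine.continuousOn_deriv3 hf
  have hne : ∀ x ∈ Ioi (0 : ℝ), genGamma C α β γ x ≠ 0 := fun x hx => (pos hC hx).ne'
  set E : ℝ → ℝ := fun x => Real.exp (-(β * x ^ γ)) with hE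
  -- The exponential is bounded by its value at the left end `x` and the power by its value at `2x`;
  -- `|α - 1|` makes the power monotone for either sign of `α - 1`.
  set G : ℝ → ℝ := fun x => C * (2 * x) ^ |α - 1| * E x with hG
  have hi : ∀ M p : ℝ, 0 ≤ p → IntegrableOn (fun x => M * (x ^ p * E x)) (Ioi 1) := fun M p hp =>
    IntegrableOn.mono_set ((integrableOn_rpow_mul_exp hβ hγ (by linarith)).const_mul M)
      (Ioi_subset_Ioi zero_le_one)
  have hGb : ∀ x, 1 < x → ∀ t ∈ Icc (0 : ℝ) 1, genGamma C α β γ (x + t) ≤ G x := by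
    intro x hx t ht
    have hxt : 1 ≤ x + t := by linarith [ht.1]
    rw [of_pos (by linarith)]
    simp only [hG, hE]
    gcongr
    · calc (x + t) ^ (α - 1) ≤ (x + t) ^ |α - 1| :=
            Real.rpow_le_rpow_of_exponent_le hxt (le_abs_self _)
        _ ≤ (2 * x) ^ |α - 1| :=
            Real.rpow_le_rpow (by linarith) (by linarith [ht.2]) (abs_nonneg _)
    · linarith [ht.1]
  have hG0 : ∀ x, 1 < x → 0 ≤ G x := fun x hx => by
    have : 0 ≤ x := by linarith
    simp only [hG, hE]; positivity
  have hvb : ∀ x, 1 < x → ∀ t ∈ Icc (0 : ℝ) 1, (x + t) ^ γ ≤ (2 * x) ^ γ := fun x hx t ht =>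
    Real.rpow_le_rpow (by linarith [ht.1]) (by linarith [ht.2]) hγ.le
  have main : ∀ h : ℝ → ℝ, ContinuousOn h (Ioi 0) → (∀ x, 0 < x → 0 ≤ h x) → ∀ D : ℝ, 0 < D →
      (∀ x, 1 ≤ x → h x ≤ D * (x ^ γ) ^ 3) →
      IntegrableOn (fun x => supShift 1 (genGamma C α β γ) x * supShift 1 h x) (Ioi 1) := by
    intro h hh hh0 D hD hb
    refine integrableOn_supShift_mul one_pos hcf hh (fun x hx => (pos hC hx).le) hh0
      (G := G) (H := fun x => D * ((2 * x) ^ γ) ^ 3) hG0 (fun x hx => ?_) hGb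
      (fun x hx t ht => ?_) ?_
    · have : 0 ≤ x := by linarith
      positivity
    · have : 0 ≤ x + t := by linarith [ht.1]
      refine (hb _ (by linarith [ht.1])).trans ?_
      gcongr D * ?_ ^ 3
      exact hvb x hx t ht
    · refine IntegrableOn.congr_fun (hi (C * D * 2 ^ |α - 1| * (2 ^ γ) ^ 3)
        (|α - 1| + γ * (3 : ℕ)) (by positivity)) (fun x hx => ?_) measurableSet_Ioi
      have hx : 0 < x := one_pos.trans hx
      simp only [hG]
      rw [Real.mul_rpow (by norm_num) hx.le, Real.mul_rpow (by norm_num) hx.le,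
        Real.rpow_add hx, Real.rpow_mul_natCast hx.le]
      ring
  refine ⟨1, one_pos, 1, one_pos, ?_, ?_, ?_, ?_⟩
  · refine Integrable.mono' (hi (C * 2 ^ |α - 1| * B ^ 2) (|α - 1| + γ * (2 : ℕ)) (by positivity))
      (ContinuousOn.aestronglyMeasurable (((hcf.inv₀ hne).mul (hcf1.pow 2)).mono
        (Ioi_subset_Ioi zero_le_one)) measurableSet_Ioi) ?_
    refine (ae_restrict_iff' measurableSet_Ioi).2 (Eventually.of_forall fun x hx => ?_)
    have hx : 1 < x := hx
    have hx0 : 0 < x := by linarith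
    have hp := pos (α := α) (β := β) (γ := γ) hC hx0
    rw [Real.norm_of_nonneg (by positivity), deriv_eq hx0]
    have e : (genGamma C α β γ x)⁻¹ * (genGamma C α β γ x * ratio₁ α β γ x / x) ^ 2 =
        genGamma C α β γ x * (|ratio₁ α β γ x| ^ 2 / x ^ 2) := by
      rw [sq_abs]; field_simp
    rw [e]
    have h1 := (hr x hx.le).1
    have h2 := hGb x hx 0 (by norm_num)
    rw [add_zero] at h2
    calc _ ≤ G x * (|ratio₁ α β γ x| ^ 2) := by
          gcongr
          exact div_le_self (by positivity) (one_le_pow₀ hx.le)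
      _ ≤ G x * (B * x ^ γ) ^ 2 := by
          have := hG0 x hx
          gcongr
      _ = _ := by
          simp only [hG]
          rw [Real.mul_rpow (by norm_num) hx0.le, Real.rpow_add hx0, Real.rpow_mul_natCast hx0.le]
          ring
  · refine main _ (((hcf.pow 3).inv₀ fun x hx => pow_ne_zero _ (hne x hx)).mul (hcf1.pow 3)).abs
      (fun _ _ => abs_nonneg _) (B ^ 3) (by positivity) fun x hx => ?_
    have hx0 : 0 < x := by linarith
    have hp := pos (α := α) (β := β) (γ := γ) hC hx0
    have e : (genGamma C α β γ x ^ 3)⁻¹ * (genGamma C α β γ x * ratio₁ α β γ x / x) ^ 3 =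
        ratio₁ α β γ x ^ 3 / x ^ 3 := by field_simp
    rw [deriv_eq hx0, e, abs_div, abs_of_pos (by positivity : 0 < x ^ 3), abs_pow, ← mul_pow]
    refine (div_le_self (by positivity) (one_le_pow₀ hx)).trans ?_
    have := (hr x hx).1
    gcongr
  · refine main _ ((((hcf.pow 2).inv₀ fun x hx => pow_ne_zero _ (hne x hx)).mul hcf1).mul hcf2).abs
      (fun _ _ => abs_nonneg _) (B ^ 2) (by positivity) fun x hx => ?_
    have hx0 : 0 < x := by linarith
    have hp := pos (α := α) (β := β) (γ := γ) hC hx0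
    have e : (genGamma C α β γ x ^ 2)⁻¹ * (genGamma C α β γ x * ratio₁ α β γ x / x) *
        (genGamma C α β γ x * ratio₂ α β γ x / x ^ 2) =
        ratio₁ α β γ x * ratio₂ α β γ x / x ^ 3 := by field_simp
    rw [deriv_eq hx0, iteratedDeriv_two_eq hx0, e, abs_div, abs_of_pos (by positivity : 0 < x ^ 3),
      abs_mul]
    refine (div_le_self (by positivity) (one_le_pow₀ hx)).trans ?_
    calc _ ≤ B * x ^ γ * (B * (x ^ γ) ^ 2) :=
          mul_le_mul (hr x hx).1 (hr x hx).2.1 (abs_nonneg _) (by positivity)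
      _ = _ := by ring
  · refine main _ ((hcf.inv₀ hne).mul hcf3).abs (fun _ _ => abs_nonneg _) B hB fun x hx => ?_
    have hx0 : 0 < x := by linarith
    have hp := pos (α := α) (β := β) (γ := γ) hC hx0
    have e : (genGamma C α β γ x)⁻¹ * (genGamma C α β γ x * ratio₃ α β γ x / x ^ 3) =
        ratio₃ α β γ x / x ^ 3 := by field_simp
    rw [iteratedDeriv_three_eq hx0, e, abs_div, abs_of_pos (by positivity : 0 < x ^ 3)]
    exact (div_le_self (by positivity) (one_le_pow₀ hx)).trans (hr x hx).2.2

lemma admissible (hC : 0 < C) (hα : 0 < α) (hβ : 0 < β) (hγ : 0 < γ) (hαγ : α = 1 → γ = 1)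
    (h1 : C * (β ^ (-α / γ) * (1 / γ) * Real.Gamma (α / γ)) = 1) :
    Admissible (genGamma C α β γ) C α :=
  ⟨isHalfLineDensity hC hα hβ hγ h1, endpointCondition hC hα hγ hαγ, tailCondition hC hβ hγ⟩

end genGamma

/-! ### The Weibull and gamma densities -/

lemma admissible_weibullPDF {α β : ℝ} (hα : 0 < α) (hβ : 0 < β) :
    Admissible (weibullPDF α β) (α * β) α := by
  -- The Weibull density is the case `γ = α`, definitionally, so the side condition at `α = 1` is
  -- the identity.
  refine genGamma.admissible (by positivity) hα hβ hα id ?_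
  rw [neg_div, div_self hα.ne', Real.rpow_neg_one, Real.Gamma_one]
  field_simp

lemma admissible_gammaPDFReal {α β : ℝ} (hα : 0 < α) (hβ : 0 < β) :
    Admissible (ProbabilityTheory.gammaPDFReal α β) (β ^ α / Real.Gamma α) α := by
  have hΓ := Real.Gamma_pos_of_pos hα
  have e : ProbabilityTheory.gammaPDFReal α β = genGamma (β ^ α / Real.Gamma α) α β 1 := by
    ext x
    simp [ProbabilityTheory.gammaPDFReal, genGamma]
  rw [e]
  refine genGamma.admissible (by positivity) hα hβ one_pos (fun _ => rfl) ?_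
  rw [div_one, div_one, Real.rpow_neg hβ.le]
  have := Real.rpow_pos_of_pos hβ α
  field_simp

end LocationShift

theorem theorem2 :
    (∀ (f : ℝ → ℝ) (A κ : ℝ), LocationShift.Admissible f A κ → ∀ θ : ℝ,
      (κ < 1 → LocationShift.UniformLimit
        (fun ε s => LocationShift.relRenyi s (LocationShift.shift f θ)
          (LocationShift.shift f (θ + ε)) / ε ^ κ)
        (fun s => (1 - κ) / κ *
          (A * s * ProbabilityTheory.beta (s + κ * (1 - s)) (1 - κ)))) ∧
      (κ = 1 → LocationShift.UniformLimit
        (fun ε s => LocationShift.relRenyi s (LocationShift.shift f θ)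
          (LocationShift.shift f (θ + ε)) / ε ^ κ)
        (fun s => A * s)) ∧
      (1 < κ → κ < 2 → LocationShift.UniformLimit
        (fun ε s => LocationShift.relRenyi s (LocationShift.shift f θ)
          (LocationShift.shift f (θ + ε)) / ε ^ κ)
        (fun s => A * s * (1 - s * (κ - 1)) *
          ProbabilityTheory.beta (s + κ * (1 - s)) (2 - κ) / κ)) ∧
      (κ = 2 → LocationShift.UniformLimit
        (fun ε s => LocationShift.relRenyi s (LocationShift.shift f θ)
          (LocationShift.shift f (θ + ε)) / (-(ε ^ 2 * Real.log ε)))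
        (fun s => A * s * (1 - s) / 2)) ∧
      (2 < κ →
        IntegrableOn (fun x => (f x)⁻¹ * deriv f x ^ 2) (Ioi 0) ∧
        LocationShift.UniformLimit
          (fun ε s => LocationShift.relRenyi s (LocationShift.shift f θ)
            (LocationShift.shift f (θ + ε)) / ε ^ 2)
          (fun s => s * (1 - s) / 2 * LocationShift.fisherInfo f))) ∧
    (∀ α β : ℝ, 0 < α → 0 < β →
      LocationShift.Admissible (LocationShift.weibullPDF α β) (α * β) α) ∧
    (∀ α β : ℝ, 0 < α → 0 < β →
      LocationShift.Admissible (ProbabilityTheory.gammaPDFReal α β)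
        (β ^ α / Real.Gamma α) α) := by
  refine ⟨fun f A κ h θ => ⟨fun hκ => h.uniformLimit_of_lt_one hκ θ,
    fun hκ => h.uniformLimit_of_eq_one hκ θ, fun _ hκ => h.uniformLimit_of_lt_two hκ θ,
    fun hκ => h.uniformLimit_of_eq_two hκ θ,
    fun hκ => ⟨h.integrableOn_fisher hκ, h.uniformLimit_of_two_lt hκ θ⟩⟩,
    fun _ _ hα hβ => LocationShift.admissible_weibullPDF hα hβ,
    fun _ _ hα hβ => LocationShift.admissible_gammaPDFReal hα hβ⟩
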